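/- Let $\mathcal H$ be a finite-dimensional complex Hilbert space and let $A,B$ be Hermitian operators on $\mathcal H$, where $A$ is not a scalar multiple of the identity. Put $U(x)=e^{2\pi i(xA+B)}$ for $x\in\mathbb R$, let $\operatorname{Spec}A\subset\mathbb R$ be the set of eigenvalues of $A$, and let $\Xi=\operatorname{Diff}\operatorname{Spec}A=\{\lambda-\lambda'\mid\lambda,\lambda'\in\operatorname{Spec}A\}$. Conventions. $\|\cdot\|$ is the operator norm. The Fourier spectrum of a bounded (complex- or operator-valued) function on $\mathbb R$ is the support of its Fourier transform as a tempered distribution, with $\hat f(\xi)=\int e^{-2\pi i\xi x}f(x)\,dx$. A function $f$ on $\mathbb R$ is of linear decay if it is continuous and there are $c,C\ge 0$ with $|x|\,\|f(x)\|\le C$ for all $|x|\ge c$. $\mathcal K_\Xi$ is the space of real-valued, bounded, continuously differentiable functions on $\mathbb R$ with Fourier spectrum contained in $\Xi$. For $K>0$, $\mathcal F^{\downarrow}_K$ is the space of real-valued analytic functions of linear decay on $\mathbb R$ with Fourier spectrum contained in $[-K,K]$. Finally $$\Gamma_A(B)=\sup_{\mathcal P}\Bigl\|B-\sum_{P\in\mathcal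 P}PBP\Bigr\|,$$ where $\mathcal P$ ranges over the families of rank-one orthogonal projectors, all commuting with $A$, onto the lines spanned by the members of an orthonormal basis of $\mathcal H$. 1. There is a function $\tilde U$ from $\mathbb R$ to the unitary operators on $\mathcal H$ such that (a) $\tilde U$ is bounded and continuous with Fourier spectrum contained in $\operatorname{Spec}A$, explicitly $\tilde U(x)=\sum_{\lambda\in\operatorname{Spec}A}e^{2\pi i\lambda x}C_\lambda$ with operators $C_\lambda$ on $\mathcal H$, and $U-\tilde U$ is of linear decay; (b) if $|x|\,\|U(x)-\tilde U(x)\|\to0$ as $x\to+\infty$ (in particular, if $U(x)-\tilde U(x)=o(1/|x|)$ as $|x|\to\infty$), then $A$ and $B$ commute; (c) $\sup_{x\in\mathbb R}\|U(x)-\tilde U(x)\|\le 2\pi\,\Gamma_A(B)$. 2. $\mathcal K_\Xi\cap\mathcal F^{\downarrow}_{\max\Xi}=\{0\}$. For every Hermitian operator $M$ and every positive (semidefinite) operator $\varrho$ on $\mathcal H$, the expectation-value function $f(x)=\operatorname{tr}\bigl(M\,e^{2\pi i(xA+B)}\varrho\,e^{-2\pi i(xA+B)}\bigr)$ belongs to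 the direct sum $\mathcal K_\Xi\oplus\mathcal F^{\downarrow}_{\max\Xi}$. That is, $f=f_1+f_0$ with $f_1\in\mathcal K_\Xi$ and $f_0\in\mathcal F^{\downarrow}_{\max\Xi}$. Moreover: - $f_1(x)=\sum_{\xi\in\Xi}b_\xi e^{2\pi i\xi x}$ with complex coefficients satisfying $b_{-\xi}=\overline{b_\xi}$; - $f_0$ is square integrable, and its $L^2$-Fourier transform vanishes almost everywhere outside $[\lambda_{\min}(A)-\lambda_{\max}(A),\ \lambda_{\max}(A)-\lambda_{\min}(A)]$; - the decomposition is unique, even in the following wider class: if $f=g_1+g_0$ with $g_1\in\mathcal K_\Xi$ and $g_0$ of linear decay, then $g_1=f_1$ and $g_0=f_0$. -/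

import Mathlib

open scoped FourierTransform SchwartzMap InnerProductSpace

namespace PerturbedParametric

noncomputable section

/-! ### Fourier spectrum -/

/-- The Fourier transform, as a tempered distribution `u ↦ ∫ (𝓕 u)(x) • f x dx`, of an essentially
bounded function `f`. -/
def distFourier {F : Type*} [NormedAddCommGroup F] [NormedSpace ℂ F] [CompleteSpace F]
    {f : ℝ → F} (hf : MeasureTheory.MemLp f ⊤ MeasureTheory.volume) : 𝓢'(ℝ, F) :=
  𝓕 (MeasureTheory.Lp.toTemperedDistribution (hf.toLp f))

theorem distFourier_apply {F : Type*} [NormedAddCommGroup F] [NormedSpace ℂ F] [CompleteSpace F]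
    {f : ℝ → F} (hf : MeasureTheory.MemLp f ⊤ MeasureTheory.volume) (u : 𝓢(ℝ, ℂ)) :
    distFourier hf u = ∫ x, (𝓕 u : 𝓢(ℝ, ℂ)) x • f x := by
  rw [distFourier, TemperedDistribution.fourier_apply,
    MeasureTheory.Lp.toTemperedDistribution_apply]
  apply MeasureTheory.integral_congr_ae
  filter_upwards [hf.coeFn_toLp] with y hy
  rw [hy]

/-- `HasSpectrumIn f S`: the function `f` is essentially bounded, and its Fourier spectrum, that is,
the support of its Fourier transform as a tempered distribution, is contained in `S`. -/
def HasSpectrumIn {F : Type*} [NormedAddCommGroup F] [NormedSpace ℂ F] [CompleteSpace F]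
    (f : ℝ → F) (S : Set ℝ) : Prop :=
  ∃ hf : MeasureTheory.MemLp f ⊤ MeasureTheory.volume, Distribution.dsupport (distFourier hf) ⊆ S

section Spectrum

variable {F : Type*} [NormedAddCommGroup F] [NormedSpace ℂ F] [CompleteSpace F]

theorem HasSpectrumIn.zero (S : Set ℝ) : HasSpectrumIn (0 : ℝ → F) S := by
  refine ⟨MeasureTheory.MemLp.zero, fun x hx => ?_⟩
  exfalso
  refine (Distribution.notMem_dsupport_iff x).2 ⟨Set.univ, fun u _ => ?_, isOpen_univ, trivial⟩ hx
  rw [distFourier_apply]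
  simp

theorem HasSpectrumIn.add {f g : ℝ → F} {S : Set ℝ} (hf : HasSpectrumIn f S)
    (hg : HasSpectrumIn g S) : HasSpectrumIn (f + g) S := by
  obtain ⟨hf, hfS⟩ := hf
  obtain ⟨hg, hgS⟩ := hg
  refine ⟨hf.add hg, fun x hx => ?_⟩
  by_contra hxS
  have h1 : x ∉ Distribution.dsupport (distFourier hf) := fun h => hxS (hfS h)
  have h2 : x ∉ Distribution.dsupport (distFourier hg) := fun h => hxS (hgS h)
  rw [Distribution.notMem_dsupport_iff] at h1 h2
  obtain ⟨s, hs, hso, hxs⟩ := h1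
  obtain ⟨t, ht, hto, hxt⟩ := h2
  refine (Distribution.notMem_dsupport_iff x).2 ⟨s ∩ t, fun u hu => ?_, hso.inter hto, hxs, hxt⟩ hx
  have e : distFourier (hf.add hg) = distFourier hf + distFourier hg := by
    rw [distFourier, distFourier, distFourier, MeasureTheory.MemLp.toLp_add,
      ← FourierTransform.fourier_add]
    congr 1
    exact (MeasureTheory.Lp.toTemperedDistributionCLM F MeasureTheory.volume ⊤).map_add _ _
  rw [e]
  change distFourier hf u + distFourier hg u = 0
  rw [hs u (hu.trans Set.inter_subset_left), ht u (hu.trans Set.inter_subset_right), add_zero]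

theorem HasSpectrumIn.smul {f : ℝ → F} {S : Set ℝ} (c : ℂ) (hf : HasSpectrumIn f S) :
    HasSpectrumIn (c • f) S := by
  obtain ⟨hf, hfS⟩ := hf
  refine ⟨hf.const_smul c, fun x hx => ?_⟩
  by_contra hxS
  have h1 : x ∉ Distribution.dsupport (distFourier hf) := fun h => hxS (hfS h)
  rw [Distribution.notMem_dsupport_iff] at h1
  obtain ⟨s, hs, hso, hxs⟩ := h1
  refine (Distribution.notMem_dsupport_iff x).2 ⟨s, fun u hu => ?_, hso, hxs⟩ hx
  have e : distFourier (hf.const_smul c) = c • distFourier hf := by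
    rw [distFourier, distFourier, MeasureTheory.MemLp.toLp_const_smul,
      ← FourierTransform.fourier_smul]
    congr 1
    exact (MeasureTheory.Lp.toTemperedDistributionCLM F MeasureTheory.volume ⊤).map_smul _ _
  rw [e]
  change c • distFourier hf u = 0
  rw [hs u hu, smul_zero]

end Spectrum

/-! ### Linear decay and function spaces -/

/-- `f` is of linear decay: it is continuous and there are constants `c, C ≥ 0` with
`‖f x‖ ≤ C / |x|` whenever `|x| ≥ c`. -/
def LinearDecay {F : Type*} [NormedAddCommGroup F] (f : ℝ → F) : Prop :=
  Continuous f ∧ ∃ c C : ℝ, 0 ≤ c ∧ 0 ≤ C ∧ ∀ x : ℝ, c ≤ |x| → |x| * ‖f x‖ ≤ C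

/-- The set of differences `{a - b | a, b ∈ S}`. -/
def diffSet (S : Set ℝ) : Set ℝ := {d | ∃ a ∈ S, ∃ b ∈ S, d = a - b}

/-- Real-valued, bounded, continuously differentiable functions on `ℝ` whose Fourier spectrum is
contained in `Ξ`. -/
def KSpace (Ξ : Set ℝ) : Submodule ℝ (ℝ → ℝ) where
  carrier := {f | ContDiff ℝ 1 f ∧ (∃ C : ℝ, ∀ x, |f x| ≤ C) ∧
    HasSpectrumIn (fun x => (f x : ℂ)) Ξ}
  zero_mem' := ⟨contDiff_const, ⟨0, by simp⟩, by
    convert HasSpectrumIn.zero (F := ℂ) Ξ using 1; ext x; simp⟩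
  add_mem' := by
    rintro f g ⟨hf, ⟨C, hC⟩, hf'⟩ ⟨hg, ⟨D, hD⟩, hg'⟩
    refine ⟨hf.add hg, ⟨C + D, fun x => (abs_add_le _ _).trans (add_le_add (hC x) (hD x))⟩, ?_⟩
    convert hf'.add hg' using 1
    ext x
    simp
  smul_mem' := by
    rintro c f ⟨hf, ⟨C, hC⟩, hf'⟩
    refine ⟨hf.const_smul c, ⟨|c| * C, fun x => ?_⟩, ?_⟩
    · simpa [abs_mul] using mul_le_mul_of_nonneg_left (hC x) (abs_nonneg c)
    · convert hf'.smul (c : ℂ) using 1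
      ext x
      simp

/-- Real-valued analytic functions of linear decay on `ℝ` whose Fourier spectrum is contained in
`[-K, K]`. -/
def DecaySpace (K : ℝ) : Submodule ℝ (ℝ → ℝ) where
  carrier := {f | (∀ x, AnalyticAt ℝ f x) ∧ LinearDecay f ∧
    HasSpectrumIn (fun x => (f x : ℂ)) (Set.Icc (-K) K)}
  zero_mem' := ⟨fun _ => analyticAt_const, ⟨continuous_const, 0, 0, le_rfl, le_rfl, by simp⟩, by
    convert HasSpectrumIn.zero (F := ℂ) (Set.Icc (-K) K) using 1; ext x; simp⟩
  add_mem' := by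
    rintro f g ⟨hf, ⟨hfc, c, C, hc, hC, h⟩, hf'⟩ ⟨hg, ⟨hgc, d, D, hd, hD, h'⟩, hg'⟩
    refine ⟨fun x => (hf x).add (hg x), ⟨hfc.add hgc, max c d, C + D, le_max_of_le_left hc,
      add_nonneg hC hD, fun x hx => ?_⟩, ?_⟩
    · calc |x| * ‖f x + g x‖ ≤ |x| * (‖f x‖ + ‖g x‖) :=
            mul_le_mul_of_nonneg_left (norm_add_le _ _) (abs_nonneg x)
        _ = |x| * ‖f x‖ + |x| * ‖g x‖ := mul_add _ _ _
        _ ≤ C + D := add_le_add (h x ((le_max_left _ _).trans hx))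
            (h' x ((le_max_right _ _).trans hx))
    · convert hf'.add hg' using 1
      ext x
      simp
  smul_mem' := by
    rintro a f ⟨hf, ⟨hfc, c, C, hc, hC, h⟩, hf'⟩
    refine ⟨fun x => analyticAt_const.smul (hf x), ⟨hfc.const_smul a, c, |a| * C, hc,
      mul_nonneg (abs_nonneg a) hC, fun x hx => ?_⟩, ?_⟩
    · calc |x| * ‖(a • f) x‖ = |a| * (|x| * ‖f x‖) := by simp; ring
        _ ≤ |a| * C := mul_le_mul_of_nonneg_left (h x hx) (abs_nonneg a)
    · convert hf'.smul (a : ℂ) using 1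
      ext x
      simp

/-! ### Operators on a finite-dimensional Hilbert space -/

variable {H : Type*} [NormedAddCommGroup H] [InnerProductSpace ℂ H] [CompleteSpace H]

/-- Bounded continuous operator-valued functions on `ℝ` whose Fourier spectrum is contained
in `Λ`. -/
def KOp (Λ : Set ℝ) : Set (ℝ → H →L[ℂ] H) :=
  {V | Continuous V ∧ (∃ C : ℝ, ∀ x, ‖V x‖ ≤ C) ∧ HasSpectrumIn V Λ}

/-- The spectrum of a (Hermitian) operator, as a set of real numbers. -/
def Spec (A : H →L[ℂ] H) : Set ℝ := {a | (a : ℂ) ∈ spectrum ℂ A}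

/-- The largest eigenvalue of a Hermitian operator. -/
def eigMax (A : H →L[ℂ] H) : ℝ := sSup (Spec A)

/-- The smallest eigenvalue of a Hermitian operator. -/
def eigMin (A : H →L[ℂ] H) : ℝ := sInf (Spec A)

/-- The perturbed-parametric unitary function `x ↦ exp (2πi (x A + B))`. -/
def ppUnitary (A B : H →L[ℂ] H) (x : ℝ) : H →L[ℂ] H :=
  NormedSpace.exp ((2 * Real.pi * Complex.I : ℂ) • ((x : ℂ) • A + B))

/-- The perturbed-parametric expectation-value function
`x ↦ tr (M exp (2πi (x A + B)) ρ exp (-2πi (x A + B)))`; the trace is a real number for Hermitian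
`A, B, M, ρ`, see `coe_evf`. -/
def evf (A B M ρ : H →L[ℂ] H) (x : ℝ) : ℝ :=
  (LinearMap.trace ℂ H ((M * ppUnitary A B x * ρ *
    NormedSpace.exp ((-(2 * Real.pi * Complex.I) : ℂ) • ((x : ℂ) • A + B)) :
      H →L[ℂ] H) : H →ₗ[ℂ] H)).re

/-- The values `‖B - ∑ P B P‖`, where the `P` are the rank-one orthogonal projectors onto the lines
spanned by the members of an orthonormal basis, all commuting with `A`. -/
def commutationValues (A B : H →L[ℂ] H) : Set ℝ :=
  {r | ∃ b : OrthonormalBasis (Fin (Module.finrank ℂ H)) ℂ H,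
    (∀ i, Commute A (InnerProductSpace.rankOne ℂ (b i) (b i))) ∧
    r = ‖B - ∑ i, InnerProductSpace.rankOne ℂ (b i) (b i) * B *
      InnerProductSpace.rankOne ℂ (b i) (b i)‖}

/-- `Γ_A(B)`, the supremum of `‖B - ∑ P B P‖` over all orthonormal bases that diagonalize `A`. -/
def commutationNorm (A B : H →L[ℂ] H) : ℝ := sSup (commutationValues A B)

theorem bddAbove_commutationValues (A B : H →L[ℂ] H) : BddAbove (commutationValues A B) := by
  refine ⟨‖B‖ + Module.finrank ℂ H * ‖B‖, ?_⟩
  rintro r ⟨b, -, rfl⟩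
  refine (norm_sub_le _ _).trans (add_le_add le_rfl ?_)
  refine (norm_sum_le_of_le _ (f := fun _ => _) (n := fun _ => ‖B‖) fun i _ => ?_).trans (by simp)
  have h1 : ‖InnerProductSpace.rankOne ℂ (b i) (b i)‖ = 1 := by simp
  refine (norm_mul_le _ _).trans ((mul_le_mul_of_nonneg_right (norm_mul_le _ _)
    (norm_nonneg _)).trans ?_)
  rw [h1, one_mul, mul_one]

theorem commutationValues_nonempty [FiniteDimensional ℂ H] {A : H →L[ℂ] H} (hA : IsSelfAdjoint A)
    (B : H →L[ℂ] H) : (commutationValues A B).Nonempty := by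
  have hs : (A : H →ₗ[ℂ] H).IsSymmetric := hA.isSymmetric
  refine ⟨_, hs.eigenvectorBasis rfl, fun i => ?_, rfl⟩
  have h : A (hs.eigenvectorBasis rfl i) = (hs.eigenvalues rfl i : ℂ) • hs.eigenvectorBasis rfl i :=
    hs.apply_eigenvectorBasis rfl i
  ext v
  have h2 : ⟪hs.eigenvectorBasis rfl i, A v⟫_ℂ
      = (hs.eigenvalues rfl i : ℂ) * ⟪hs.eigenvectorBasis rfl i, v⟫_ℂ := by
    have := hs (hs.eigenvectorBasis rfl i) v
    simp only [ContinuousLinearMap.coe_coe] at this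
    rw [← this, h, inner_smul_left]
    simp
  simp only [mul_apply_eq_comp, InnerProductSpace.rankOne_apply, map_smul, h, h2]
  rw [smul_smul, mul_comm]

theorem coe_evf [FiniteDimensional ℂ H] {A B M ρ : H →L[ℂ] H} (hA : IsSelfAdjoint A)
    (hB : IsSelfAdjoint B) (hM : IsSelfAdjoint M) (hρ : IsSelfAdjoint ρ) (x : ℝ) :
    (evf A B M ρ x : ℂ) = LinearMap.trace ℂ H ((M * ppUnitary A B x * ρ *
      NormedSpace.exp ((-(2 * Real.pi * Complex.I) : ℂ) • ((x : ℂ) • A + B)) :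
        H →L[ℂ] H) : H →ₗ[ℂ] H) := by
  have key : ∀ T : H →L[ℂ] H, star (LinearMap.trace ℂ H (T : H →ₗ[ℂ] H))
      = LinearMap.trace ℂ H ((star T : H →L[ℂ] H) : H →ₗ[ℂ] H) := by
    intro T
    rw [LinearMap.trace_eq_sum_inner _ (stdOrthonormalBasis ℂ H),
      LinearMap.trace_eq_sum_inner _ (stdOrthonormalBasis ℂ H), star_sum]
    refine Finset.sum_congr rfl fun i _ => ?_
    simp only [ContinuousLinearMap.coe_coe, ContinuousLinearMap.star_eq_adjoint]
    rw [ContinuousLinearMap.adjoint_inner_right]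
    exact inner_conj_symm _ _
  have hS : star ((x : ℂ) • A + B) = (x : ℂ) • A + B := by
    rw [star_add, star_smul, hA.star_eq, hB.star_eq]; simp
  have hU : star (ppUnitary A B x)
      = NormedSpace.exp ((-(2 * Real.pi * Complex.I) : ℂ) • ((x : ℂ) • A + B)) := by
    rw [ppUnitary, NormedSpace.star_exp, star_smul, hS]; congr 2; simp
  rw [evf, ← hU]
  refine Complex.conj_eq_iff_re.1 ?_
  refine (key _).trans ?_
  simp only [star_mul, star_star, hM.star_eq, hρ.star_eq]
  have e : ppUnitary A B x * (ρ * (star (ppUnitary A B x) * M))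
      = (ppUnitary A B x * ρ * star (ppUnitary A B x)) * M := by simp only [mul_assoc]
  rw [e, mul_assoc M, mul_assoc M]
  exact LinearMap.trace_mul_comm ℂ _ _

end

end PerturbedParametric

open PerturbedParametric

/-!
Let `D = ∑ P B P` be the pinching of `B` by the eigenprojectors `P` of `A`. It commutes with `A`, so
`V x = exp (2πi (x A + D))` is a trigonometric polynomial with frequencies in `Spec A`, and it is
the function compared with `U x = exp (2πi (x A + B))`.

Both bounds on `U - V` come from Duhamel's estimate `‖e^a w - w e^b‖ ≤ ‖a w - w b‖` for skew-adjoint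
`a` and `b` (`norm_exp_mul_sub_mul_exp_le`). The choice `w = 1` gives `‖U - V‖ ≤ 2π ‖B - D‖`, and
`‖B - D‖` is one of the values defining `Γ_A(B)`, attained in a common eigenbasis of `A` and `D`
(`norm_sub_pinching_le_commutationNorm`). The choice `w = x + Y`, where `[A, Y] = D - B`, makes the
intertwining error independent of `x`, and this is the linear decay
(`abs_mul_norm_ppUnitary_sub_le`). If moreover `x (U - V) → 0`, the identity
`[V, B - D] = [x A + B, U - V]` shows that `[V, B - D] → 0`. Its blocks between eigenspaces of `A`
are combinations of two exponentials with different frequencies, so `B - D = 0`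
(`commute_of_tendsto`).

The expectation value splits as `f₁ + f₀`, where `f₁` is the same expectation value with `D` in
place of `B`; it is a trigonometric polynomial with frequencies in `Diff Spec A`, and `f₀` inherits
linear decay from `U - V`. That the Fourier spectrum of `f` lies in `[-max Ξ, max Ξ]` follows from
the Lie–Trotter formula: `f` is a bounded pointwise limit of trigonometric polynomials with
frequencies in this interval (`hasSpectrumIn_evf`), and the spectrum condition passes to such limits
by dominated convergence (`hasSpectrumIn_of_tendsto`).

Finally, a function of linear decay is square integrable, so its distributional Fourier transform is
an `L²` function; if its Fourier spectrum is finite, that function vanishes almost everywhere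
(`LinearDecay.eq_zero_of_hasSpectrumIn`). Thus an element of `K_Ξ` of linear decay is zero, which
gives the directness of the sum and the uniqueness of the decomposition.
-/

namespace PerturbedParametric

/-! ### Exponentials of skew-adjoint elements -/

section Exponential

open NormedSpace Filter Topology

variable {𝔸 : Type*} [CStarAlgebra 𝔸]

theorem exp_smul_mem_unitary {a : 𝔸} (ha : a ∈ skewAdjoint 𝔸) (t : ℝ) :
    exp (t • a) ∈ unitary 𝔸 :=
  let : NormedAlgebra ℚ 𝔸 := NormedAlgebra.restrictScalars ℚ ℂ 𝔸
  exp_mem_unitary_of_mem_skewAdjoint (skewAdjoint.smul_mem t ha)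

/-- Duhamel's estimate: the left-hand side is the norm of `∫₀¹ e^{sa} (aw - wb) e^{(1-s)b} ds`,
whose outer factors are unitary. -/
theorem norm_exp_mul_sub_mul_exp_le {a b : 𝔸} (ha : a ∈ skewAdjoint 𝔸) (hb : b ∈ skewAdjoint 𝔸)
    (w : 𝔸) : ‖exp a * w - w * exp b‖ ≤ ‖a * w - w * b‖ := by
  have hd : ∀ s : ℝ, HasDerivAt (fun s : ℝ => exp (s • a) * w * exp ((1 - s) • b))
      (exp (s • a) * (a * w - w * b) * exp ((1 - s) • b)) s := by
    intro s
    have h1 := (hasDerivAt_exp_smul_const a s).mul_const w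
    have h2 := (hasDerivAt_exp_smul_const' b (1 - s)).scomp s ((hasDerivAt_id s).const_sub 1)
    refine (h1.mul h2).congr_deriv ?_
    simp only [Function.comp, neg_smul, one_smul]
    noncomm_ring
  have hb' : ∀ s ∈ Set.Ico (0 : ℝ) 1,
      ‖exp (s • a) * (a * w - w * b) * exp ((1 - s) • b)‖ ≤ ‖a * w - w * b‖ := by
    intro s _
    rw [CStarRing.norm_mul_mem_unitary _ (exp_smul_mem_unitary hb _),
      CStarRing.norm_mem_unitary_mul _ (exp_smul_mem_unitary ha _)]
  simpa using norm_image_sub_le_of_norm_deriv_le_segment_01'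
    (fun s _ => (hd s).hasDerivWithinAt) hb'

theorem norm_pow_sub_pow_le_of_mem_unitary {u v : 𝔸} (hu : u ∈ unitary 𝔸) (hv : v ∈ unitary 𝔸)
    (n : ℕ) : ‖u ^ n - v ^ n‖ ≤ n * ‖u - v‖ := by
  induction n with
  | zero => simp
  | succ n ih =>
    have e : u ^ (n + 1) - v ^ (n + 1) = u ^ n * (u - v) + (u ^ n - v ^ n) * v := by
      rw [pow_succ, pow_succ]; noncomm_ring
    rw [e]
    refine (norm_add_le _ _).trans ?_
    rw [CStarRing.norm_mul_mem_unitary _ hv, CStarRing.norm_mem_unitary_mul _ (pow_mem hu n)]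
    push_cast
    linarith

/-- The Lie–Trotter product formula for skew-adjoint elements. -/
theorem tendsto_exp_mul_exp_pow {a b : 𝔸} (ha : a ∈ skewAdjoint 𝔸) (hb : b ∈ skewAdjoint 𝔸) :
    Tendsto (fun n : ℕ => (exp ((n : ℝ)⁻¹ • a) * exp ((n : ℝ)⁻¹ • b)) ^ n) atTop
      (𝓝 (exp (a + b))) := by
  have hab : a + b ∈ skewAdjoint 𝔸 := add_mem ha hb
  have hd : HasDerivAt (fun t : ℝ => exp (t • a) * exp (t • b) - exp (t • (a + b))) 0 0 := by
    have h := ((hasDerivAt_exp_smul_const a (0 : ℝ)).mul (hasDerivAt_exp_smul_const b (0 : ℝ))).sub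
      (hasDerivAt_exp_smul_const (a + b) (0 : ℝ))
    refine h.congr_deriv ?_
    simp
  have h0 : Tendsto (fun n : ℕ => (n : ℝ)⁻¹) atTop (𝓝[≠] 0) :=
    tendsto_nhdsWithin_iff.2 ⟨tendsto_inv_atTop_nhds_zero_nat,
      (eventually_ne_atTop 0).mono fun n hn => by simpa using hn⟩
  -- The difference and its derivative vanish at `0`, so `n` times its value at `1 / n` goes to `0`.
  have hs := (hd.tendsto_slope_zero.comp h0).norm
  simp only [Function.comp, zero_add, zero_smul, exp_zero, mul_one, sub_self, sub_zero, inv_inv,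
    norm_smul, norm_zero] at hs
  rw [tendsto_iff_norm_sub_tendsto_zero]
  refine squeeze_zero' (.of_forall fun n => norm_nonneg _) ?_ hs
  filter_upwards [eventually_ne_atTop 0] with n hn
  have hn' : (n : ℝ) ≠ 0 := by exact_mod_cast hn
  let : NormedAlgebra ℚ 𝔸 := NormedAlgebra.restrictScalars ℚ ℂ 𝔸
  have e : exp (a + b) = exp ((n : ℝ)⁻¹ • (a + b)) ^ n := by
    rw [← exp_nsmul, ← Nat.cast_smul_eq_nsmul ℝ, smul_smul, mul_inv_cancel₀ hn', one_smul]
  rw [e]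
  refine (norm_pow_sub_pow_le_of_mem_unitary (mul_mem (exp_smul_mem_unitary ha _)
    (exp_smul_mem_unitary hb _)) (exp_smul_mem_unitary hab _) n).trans_eq ?_
  simp

end Exponential

/-! ### Fourier spectrum and trigonometric polynomials -/

section FourierSpectrum

open MeasureTheory Filter Topology

variable {E : Type*} [NormedAddCommGroup E] [NormedSpace ℂ E]

theorem hasSpectrumIn_of_forall_integral_eq_zero [CompleteSpace E] {f : ℝ → E} {S : Set ℝ}
    (hS : IsClosed S) (hf : MemLp f ⊤ volume)
    (h : ∀ u : 𝓢(ℝ, ℂ), tsupport u ⊆ Sᶜ → ∫ x, (𝓕 u : 𝓢(ℝ, ℂ)) x • f x = 0) :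
    HasSpectrumIn f S := by
  refine ⟨hf, fun x hx => ?_⟩
  by_contra hxS
  exact (Distribution.notMem_dsupport_iff x).2
    ⟨Sᶜ, fun u hu => (distFourier_apply hf u).trans (h u hu), hS.isOpen_compl, hxS⟩ hx

/-- The distributional Fourier transform of a bounded square integrable function is its
`L²`-Fourier transform, so the latter vanishes almost everywhere outside the Fourier spectrum. -/
theorem ae_fourier_toLp_eq_zero {f : ℝ → ℂ} {S : Set ℝ} (hf : HasSpectrumIn f S)
    (h2 : MemLp f 2 volume) :
    ∀ᵐ ξ : ℝ, ξ ∉ S → (𝓕 (h2.toLp f) : Lp ℂ 2 (volume : Measure ℝ)) ξ = 0 := by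
  obtain ⟨hf, hS⟩ := hf
  set g : Lp ℂ 2 (volume : Measure ℝ) := 𝓕 (h2.toLp f) with hg
  have key : ∀ u : 𝓢(ℝ, ℂ), ∫ x, u x • g x = distFourier hf u := by
    intro u
    rw [← Lp.toTemperedDistribution_apply, hg, ← Lp.fourier_toTemperedDistribution_eq,
      TemperedDistribution.fourier_apply, Lp.toTemperedDistribution_apply, distFourier_apply]
    refine integral_congr_ae ?_
    filter_upwards [h2.coeFn_toLp] with y hy
    rw [hy]
  rw [ae_iff]
  refine measure_null_of_locally_null _ fun x hx => ?_
  have hxS : x ∉ S ∧ g x ≠ 0 := by simpa using hx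
  have hx' : x ∉ Distribution.dsupport (distFourier hf) := fun h => hxS.1 (hS h)
  obtain ⟨s, hs, hso, hxs⟩ := (Distribution.notMem_dsupport_iff x).1 hx'
  have hz : ∀ᵐ ξ : ℝ, ξ ∈ s → g ξ = 0 := by
    refine hso.ae_eq_zero_of_integral_contDiff_smul_eq_zero
      (((Lp.memLp g).locallyIntegrable (by norm_num)).locallyIntegrableOn s) fun φ hφ hφc hφs => ?_
    have hc : HasCompactSupport (Complex.ofRealCLM ∘ φ) := hφc.comp_left rfl
    have hd : ContDiff ℝ (⊤ : ℕ∞) (Complex.ofRealCLM ∘ φ) := by fun_prop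
    have hsub : tsupport (hc.toSchwartzMap hd) ⊆ s :=
      (closure_mono (Function.support_comp_subset (g := Complex.ofRealCLM) (by simp) φ)).trans hφs
    have := (key (hc.toSchwartzMap hd)).trans (hs _ hsub)
    simpa using this
  refine ⟨s ∩ {ξ | g ξ ≠ 0}, ?_, ?_⟩
  · refine mem_nhdsWithin.2 ⟨s, hso, hxs, fun y hy => ⟨hy.1, ?_⟩⟩
    have : y ∉ S ∧ g y ≠ 0 := by simpa using hy.2
    exact this.2
  · rw [ae_iff] at hz
    convert hz using 2
    ext y
    simp

theorem LinearDecay.memLp_two {F : Type*} [NormedAddCommGroup F] {f : ℝ → F}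
    (hf : LinearDecay f) : MemLp f 2 volume := by
  obtain ⟨hc, c, C, hc0, hC0, h⟩ := hf
  have hd : c ≤ max c 1 ∧ 1 ≤ max c 1 := ⟨le_max_left _ _, le_max_right _ _⟩
  set d := max c 1
  obtain ⟨M, hM⟩ := (isCompact_Icc (a := -d) (b := d)).exists_bound_of_continuousOn
    hc.continuousOn
  have hb : ∀ x, (1 + x ^ 2) * ‖f x‖ ^ 2 ≤ (1 + d ^ 2) * M ^ 2 + 2 * C ^ 2 := by
    intro x
    rcases le_total |x| d with hx | hx
    · have h1 : ‖f x‖ ^ 2 ≤ M ^ 2 := pow_le_pow_left₀ (norm_nonneg _) (hM x (abs_le.1 hx)) 2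
      have h2 : x ^ 2 ≤ d ^ 2 := sq_le_sq' (abs_le.1 hx).1 (abs_le.1 hx).2
      have := mul_le_mul (add_le_add_right h2 1) h1 (by positivity) (by positivity)
      linarith [sq_nonneg C]
    · have h1 : (|x| * ‖f x‖) ^ 2 ≤ C ^ 2 :=
        pow_le_pow_left₀ (by positivity) (h x (hd.1.trans hx)) 2
      rw [mul_pow, sq_abs] at h1
      have h2 : 1 ≤ x ^ 2 := by
        rw [← sq_abs]; exact one_le_pow₀ (hd.2.trans hx)
      have h3 := mul_le_mul_of_nonneg_right h2 (sq_nonneg ‖f x‖)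
      have : 0 ≤ (1 + d ^ 2) * M ^ 2 := by positivity
      linarith
  rw [memLp_two_iff_integrable_sq_norm hc.aestronglyMeasurable]
  refine (integrable_inv_one_add_sq.const_mul ((1 + d ^ 2) * M ^ 2 + 2 * C ^ 2)).mono'
    (hc.norm.pow 2).aestronglyMeasurable (.of_forall fun x => ?_)
  rw [Real.norm_of_nonneg (by positivity), ← div_eq_mul_inv, le_div_iff₀ (by positivity), mul_comm]
  exact hb x

/-- A function of linear decay is square integrable, and its `L²`-Fourier transform lives on its
Fourier spectrum; hence a Fourier spectrum of measure zero forces the function to vanish. -/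
theorem LinearDecay.eq_zero_of_hasSpectrumIn {f : ℝ → ℂ} {S : Set ℝ} (hd : LinearDecay f)
    (hf : HasSpectrumIn f S) (hS : volume S = 0) : f = 0 := by
  have h := ae_fourier_toLp_eq_zero hf hd.memLp_two
  have h0 : 𝓕 (hd.memLp_two.toLp f) = (0 : Lp ℂ 2 (volume : Measure ℝ)) := by
    rw [Lp.eq_zero_iff_ae_eq_zero]
    filter_upwards [h, measure_eq_zero_iff_ae_notMem.1 hS] with ξ h1 h2 using h1 h2
  have h1 : hd.memLp_two.toLp f = 0 := by
    rw [← norm_eq_zero, ← Lp.norm_fourier_eq, h0, norm_zero]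
  have h2 : f =ᵐ[volume] 0 := (hd.memLp_two.toLp_eq_toLp_iff MemLp.zero).1 h1
  exact (hd.1.ae_eq_iff_eq volume continuous_const).1 h2

/-- Trigonometric polynomials with coefficients in `E` and frequencies in `S`: the finite sums of
functions `x ↦ e^{2πiξx} c` with `ξ ∈ S` and `c ∈ E`. -/
def trigPoly (E : Type*) [NormedAddCommGroup E] [NormedSpace ℂ E] (S : Set ℝ) :
    Submodule ℂ (ℝ → E) :=
  Submodule.span ℂ {F | ∃ ξ ∈ S, ∃ c : E,
    F = fun x : ℝ => Complex.exp (2 * Real.pi * Complex.I * ξ * x) • c}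

theorem exp_smul_mem_trigPoly {S : Set ℝ} {ξ : ℝ} (hξ : ξ ∈ S) (c : E) :
    (fun x : ℝ => Complex.exp (2 * Real.pi * Complex.I * ξ * x) • c) ∈ trigPoly E S :=
  Submodule.subset_span ⟨ξ, hξ, c, rfl⟩

theorem const_mem_trigPoly {S : Set ℝ} (hS : 0 ∈ S) (c : E) :
    (fun _ : ℝ => c) ∈ trigPoly E S := by
  simpa using exp_smul_mem_trigPoly hS c

theorem mul_mem_trigPoly {𝔸 : Type*} [NormedRing 𝔸] [NormedAlgebra ℂ 𝔸] {S T R : Set ℝ}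
    (h : ∀ s ∈ S, ∀ t ∈ T, s + t ∈ R) {F G : ℝ → 𝔸} (hF : F ∈ trigPoly 𝔸 S)
    (hG : G ∈ trigPoly 𝔸 T) : F * G ∈ trigPoly 𝔸 R := by
  have := Submodule.mul_mem_mul hF hG
  rw [trigPoly, trigPoly, Submodule.span_mul_span] at this
  refine Submodule.span_mono ?_ this
  rintro _ ⟨_, ⟨s, hs, c, rfl⟩, _, ⟨t, ht, d, rfl⟩, rfl⟩
  refine ⟨s + t, h s hs t ht, c * d, ?_⟩
  ext x
  simp only [Pi.mul_apply, smul_mul_smul_comm, ← Complex.exp_add]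
  congr 2
  push_cast
  ring

theorem pow_mem_trigPoly {𝔸 : Type*} [NormedRing 𝔸] [NormedAlgebra ℂ 𝔸] {l u : ℝ} {F : ℝ → 𝔸}
    (hF : F ∈ trigPoly 𝔸 (Set.Icc l u)) (n : ℕ) :
    F ^ n ∈ trigPoly 𝔸 (Set.Icc (n * l) (n * u)) := by
  induction n with
  | zero =>
    simpa using!
      const_mem_trigPoly (S := Set.Icc ((0 : ℕ) * l) ((0 : ℕ) * u)) (by simp) (1 : 𝔸)
  | succ n ih =>
    rw [pow_succ]
    refine mul_mem_trigPoly (fun s hs t ht => ?_) ih hF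
    push_cast
    constructor
    · linarith [hs.1, ht.1]
    · linarith [hs.2, ht.2]

theorem star_mem_trigPoly {𝔸 : Type*} [CStarAlgebra 𝔸] {S T : Set ℝ} (h : ∀ s ∈ S, -s ∈ T)
    {F : ℝ → 𝔸} (hF : F ∈ trigPoly 𝔸 S) : star F ∈ trigPoly 𝔸 T := by
  induction hF using Submodule.span_induction with
  | mem F hF =>
    obtain ⟨ξ, hξ, c, rfl⟩ := hF
    convert exp_smul_mem_trigPoly (h ξ hξ) (star c) using 1
    ext x
    simp [← Complex.exp_conj, map_ofNat]
  | zero => simp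
  | add F G _ _ hF hG => rw [star_add]; exact add_mem hF hG
  | smul a F _ hF => rw [star_smul]; exact Submodule.smul_mem _ _ hF

theorem comp_mem_trigPoly {G : Type*} [NormedAddCommGroup G] [NormedSpace ℂ G] (L : E →L[ℂ] G)
    {S : Set ℝ} {F : ℝ → E} (hF : F ∈ trigPoly E S) : (fun x => L (F x)) ∈ trigPoly G S := by
  induction hF using Submodule.span_induction with
  | mem F hF =>
    obtain ⟨ξ, hξ, c, rfl⟩ := hF
    simpa using exp_smul_mem_trigPoly hξ (L c)
  | zero => convert (trigPoly G S).zero_mem using 1; ext x; simp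
  | add F G _ _ hF hG => simpa using! add_mem hF hG
  | smul a F _ hF => simpa using! Submodule.smul_mem _ a hF

theorem continuous_of_mem_trigPoly {S : Set ℝ} {F : ℝ → E} (hF : F ∈ trigPoly E S) :
    Continuous F := by
  induction hF using Submodule.span_induction with
  | mem F hF => obtain ⟨ξ, hξ, c, rfl⟩ := hF; fun_prop
  | zero => exact continuous_const
  | add F G _ _ hF hG => exact hF.add hG
  | smul a F _ hF => exact hF.const_smul a

theorem exists_norm_le_of_mem_trigPoly {S : Set ℝ} {F : ℝ → E} (hF : F ∈ trigPoly E S) :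
    ∃ C, ∀ x, ‖F x‖ ≤ C := by
  induction hF using Submodule.span_induction with
  | mem F hF =>
    obtain ⟨ξ, hξ, c, rfl⟩ := hF
    refine ⟨‖c‖, fun x => ?_⟩
    rw [norm_smul, Complex.norm_exp]
    simp
  | zero => exact ⟨0, by simp⟩
  | add F G _ _ hF hG =>
    obtain ⟨C, hC⟩ := hF
    obtain ⟨D, hD⟩ := hG
    exact ⟨C + D, fun x => (norm_add_le _ _).trans (add_le_add (hC x) (hD x))⟩
  | smul a F _ hF =>
    obtain ⟨C, hC⟩ := hF
    refine ⟨‖a‖ * C, fun x => ?_⟩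
    rw [Pi.smul_apply, norm_smul]
    exact mul_le_mul_of_nonneg_left (hC x) (norm_nonneg a)

theorem integrable_schwartz_smul (u : 𝓢(ℝ, ℂ)) {F : ℝ → E} (hF : Continuous F) {C : ℝ}
    (hC : ∀ x, ‖F x‖ ≤ C) : Integrable fun x => u x • F x :=
  u.integrable.smul_bdd C hF.aestronglyMeasurable (.of_forall hC)

/-- By Fourier inversion, `∫ (𝓕 u)(x) e^{2πiξx} c dx = u(ξ) c`, which is `0` for `ξ` outside the
support of `u`. -/
theorem integral_fourier_smul_eq_zero_of_mem_trigPoly [CompleteSpace E] {S : Set ℝ} {F : ℝ → E}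
    (hF : F ∈ trigPoly E S) {u : 𝓢(ℝ, ℂ)} (hu : tsupport u ⊆ Sᶜ) :
    ∫ x, (𝓕 u : 𝓢(ℝ, ℂ)) x • F x = 0 := by
  induction hF using Submodule.span_induction with
  | mem F hF =>
    obtain ⟨ξ, hξ, c, rfl⟩ := hF
    have h0 : u ξ = 0 := image_eq_zero_of_notMem_tsupport fun h => hu h hξ
    have h1 : ∫ x, (𝓕 u : 𝓢(ℝ, ℂ)) x * Complex.exp (2 * Real.pi * Complex.I * ξ * x) = u ξ := by
      conv_rhs => rw [← FourierTransform.fourierInv_fourier_eq (F := 𝓢(ℝ, ℂ)) u]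
      rw [SchwartzMap.fourierInv_coe, Real.fourierInv_eq']
      refine integral_congr_ae (.of_forall fun x => ?_)
      simp only [smul_eq_mul]
      rw [mul_comm]
      congr 2
      simp
      ring
    simp_rw [smul_smul]
    rw [integral_smul_const, h1, h0, zero_smul]
  | zero => simp
  | add F G hF' hG' hF hG =>
    obtain ⟨C, hC⟩ := exists_norm_le_of_mem_trigPoly hF'
    obtain ⟨D, hD⟩ := exists_norm_le_of_mem_trigPoly hG'
    simp only [Pi.add_apply, smul_add]
    rw [integral_add (integrable_schwartz_smul _ (continuous_of_mem_trigPoly hF') hC)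
      (integrable_schwartz_smul _ (continuous_of_mem_trigPoly hG') hD), hF, hG, add_zero]
  | smul a F _ hF =>
    simp only [Pi.smul_apply]
    simp_rw [smul_comm _ a]
    rw [integral_smul, hF, smul_zero]

/-- A pointwise limit of uniformly bounded trigonometric polynomials with frequencies in a closed
set `S` has Fourier spectrum in `S`, by dominated convergence. -/
theorem hasSpectrumIn_of_tendsto [CompleteSpace E] {S : Set ℝ} (hS : IsClosed S)
    {F : ℕ → ℝ → E} {f : ℝ → E} (hF : ∀ n, F n ∈ trigPoly E S) {C : ℝ} (hC : ∀ n x, ‖F n x‖ ≤ C)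
    (hf : Continuous f) (h : ∀ x, Tendsto (fun n => F n x) atTop (𝓝 (f x))) :
    HasSpectrumIn f S := by
  have hfC : ∀ x, ‖f x‖ ≤ C := fun x =>
    le_of_tendsto (h x).norm (.of_forall fun n => hC n x)
  refine hasSpectrumIn_of_forall_integral_eq_zero hS
    (memLp_top_of_bound hf.aestronglyMeasurable C (.of_forall hfC)) fun u hu => ?_
  refine tendsto_nhds_unique (tendsto_integral_of_dominated_convergence
    (fun x => ‖(𝓕 u : 𝓢(ℝ, ℂ)) x‖ * C) (fun n => ?_) ?_ (fun n => .of_forall fun x => ?_)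
    (.of_forall fun x => (h x).const_smul ((𝓕 u : 𝓢(ℝ, ℂ)) x)))
    (tendsto_const_nhds.congr fun n =>
      (integral_fourier_smul_eq_zero_of_mem_trigPoly (hF n) hu).symm)
  · exact (integrable_schwartz_smul _ (continuous_of_mem_trigPoly (hF n))
      (hC n)).aestronglyMeasurable
  · exact (𝓕 u : 𝓢(ℝ, ℂ)).integrable.norm.mul_const C
  · rw [norm_smul]
    exact mul_le_mul_of_nonneg_left (hC n x) (norm_nonneg _)

theorem hasSpectrumIn_of_mem_trigPoly [CompleteSpace E] {S : Set ℝ} (hS : IsClosed S) {f : ℝ → E}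
    (hf : f ∈ trigPoly E S) : HasSpectrumIn f S :=
  have ⟨_, hC⟩ := exists_norm_le_of_mem_trigPoly hf
  hasSpectrumIn_of_tendsto hS (fun _ => hf) (fun _ => hC) (continuous_of_mem_trigPoly hf)
    fun _ => tendsto_const_nhds

end FourierSpectrum

/-! ### Eigenprojectors and the pinching -/

section Pinching

variable {H : Type*} [NormedAddCommGroup H] [InnerProductSpace ℂ H] [CompleteSpace H]

/-- The orthogonal projector onto the eigenspace of `A` for the real number `a`; it is `0` if `a`
is not an eigenvalue. -/
noncomputable def eigenProj (A : H →L[ℂ] H) (a : ℝ) : H →L[ℂ] H :=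
  (Module.End.eigenspace (A : H →ₗ[ℂ] H) (a : ℂ)).starProjection

variable {A B : H →L[ℂ] H}

theorem star_eigenProj (A : H →L[ℂ] H) (a : ℝ) : star (eigenProj A a) = eigenProj A a :=
  isSelfAdjoint_starProjection _

theorem eigenProj_mul_self (A : H →L[ℂ] H) (a : ℝ) :
    eigenProj A a * eigenProj A a = eigenProj A a :=
  Submodule.isIdempotentElem_starProjection _

theorem mul_eigenProj (A : H →L[ℂ] H) (a : ℝ) : A * eigenProj A a = (a : ℂ) • eigenProj A a := by
  ext v
  exact Module.End.mem_eigenspace_iff.1 (Submodule.starProjection_apply_mem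
    (Module.End.eigenspace (A : H →ₗ[ℂ] H) (a : ℂ)) v)

theorem eigenProj_mul (hA : IsSelfAdjoint A) (a : ℝ) :
    eigenProj A a * A = (a : ℂ) • eigenProj A a := by
  have := congrArg star (mul_eigenProj A a)
  rwa [star_mul, star_smul, hA.star_eq, star_eigenProj, RCLike.star_def, Complex.conj_ofReal]
    at this

theorem eigenProj_mul_of_ne (hA : IsSelfAdjoint A) {a b : ℝ} (h : a ≠ b) :
    eigenProj A a * eigenProj A b = 0 := by
  have h1 : (a : ℂ) • (eigenProj A a * eigenProj A b)
      = (b : ℂ) • (eigenProj A a * eigenProj A b) := by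
    rw [← smul_mul_assoc, ← eigenProj_mul hA, mul_assoc, mul_eigenProj, mul_smul_comm]
  rw [← sub_eq_zero, ← sub_smul, smul_eq_zero, sub_eq_zero] at h1
  exact h1.resolve_left (by exact_mod_cast h)

variable [FiniteDimensional ℂ H]

theorem finite_Spec (A : H →L[ℂ] H) : (Spec A).Finite := by
  have h : (spectrum ℂ A).Finite := by
    rw [ContinuousLinearMap.spectrum_eq]
    exact Module.End.finite_spectrum _
  exact h.preimage Complex.ofReal_injective.injOn

/-- The eigenvalues of `A`, as a finite set of real numbers. -/
noncomputable def specFinset (A : H →L[ℂ] H) : Finset ℝ := (finite_Spec A).toFinset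

theorem coe_specFinset (A : H →L[ℂ] H) : (specFinset A : Set ℝ) = Spec A :=
  (finite_Spec A).coe_toFinset

theorem sum_eigenProj (hA : IsSelfAdjoint A) : ∑ a ∈ specFinset A, eigenProj A a = 1 := by
  have hs : (A : H →ₗ[ℂ] H).IsSymmetric := hA.isSymmetric
  refine ContinuousLinearMap.coe_injective ((hs.eigenvectorBasis rfl).toBasis.ext fun i => ?_)
  set v := (hs.eigenvectorBasis rfl) i with hv
  set α := hs.eigenvalues rfl i with hα
  have h1 : eigenProj A α v = v := by
    refine Submodule.starProjection_eq_self_iff.2 (Module.End.mem_eigenspace_iff.2 ?_)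
    exact hs.apply_eigenvectorBasis rfl i
  have h2 : α ∈ specFinset A := by
    rw [← Finset.mem_coe, coe_specFinset, Spec, Set.mem_ofPred_eq, ContinuousLinearMap.spectrum_eq,
      ← Module.End.hasEigenvalue_iff_mem_spectrum]
    exact hs.hasEigenvalue_eigenvalues rfl i
  have h3 : (∑ a ∈ specFinset A, eigenProj A a) v = v := by
    rw [sum_apply, Finset.sum_eq_single_of_mem α h2, h1]
    intro b _ hb
    rw [← h1, ← mul_apply_eq_comp, eigenProj_mul_of_ne hA hb]
    simp
  simpa [← hv] using h3

theorem Spec_nonempty [Nontrivial H] (hA : IsSelfAdjoint A) : (Spec A).Nonempty := by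
  rw [← coe_specFinset, Finset.coe_nonempty, Finset.nonempty_iff_ne_empty]
  intro h
  have := sum_eigenProj hA
  rw [h, Finset.sum_empty] at this
  exact zero_ne_one this

/-- The pinching `∑ P B P` of `B` by the eigenprojectors `P` of `A`. -/
noncomputable def pinching (A B : H →L[ℂ] H) : H →L[ℂ] H :=
  ∑ a ∈ specFinset A, eigenProj A a * B * eigenProj A a

theorem isSelfAdjoint_pinching (A : H →L[ℂ] H) (hB : IsSelfAdjoint B) :
    IsSelfAdjoint (pinching A B) := by
  rw [IsSelfAdjoint, pinching, star_sum]
  refine Finset.sum_congr rfl fun a _ => ?_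
  rw [star_mul, star_mul, star_eigenProj, hB.star_eq, mul_assoc]

theorem eigenProj_mul_pinching (hA : IsSelfAdjoint A) (B : H →L[ℂ] H) {a : ℝ}
    (ha : a ∈ specFinset A) :
    eigenProj A a * pinching A B = eigenProj A a * B * eigenProj A a := by
  rw [pinching, Finset.mul_sum, Finset.sum_eq_single_of_mem a ha]
  · simp only [← mul_assoc, eigenProj_mul_self]
  · intro b _ hb
    simp only [← mul_assoc, eigenProj_mul_of_ne hA hb.symm, zero_mul]

theorem pinching_mul_eigenProj (hA : IsSelfAdjoint A) (B : H →L[ℂ] H) {a : ℝ}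
    (ha : a ∈ specFinset A) :
    pinching A B * eigenProj A a = eigenProj A a * B * eigenProj A a := by
  rw [pinching, Finset.sum_mul, Finset.sum_eq_single_of_mem a ha]
  · simp only [mul_assoc, eigenProj_mul_self]
  · intro b _ hb
    simp only [mul_assoc, eigenProj_mul_of_ne hA hb, mul_zero]

theorem commute_eigenProj_pinching (hA : IsSelfAdjoint A) (B : H →L[ℂ] H) {a : ℝ}
    (ha : a ∈ specFinset A) : Commute (eigenProj A a) (pinching A B) :=
  (eigenProj_mul_pinching hA B ha).trans (pinching_mul_eigenProj hA B ha).symm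

theorem commute_pinching (hA : IsSelfAdjoint A) (B : H →L[ℂ] H) : Commute A (pinching A B) := by
  refine Commute.sum_right _ _ _ fun a _ => ?_
  rw [Commute, SemiconjBy]
  calc A * (eigenProj A a * B * eigenProj A a) = (A * eigenProj A a) * B * eigenProj A a := by
        simp only [mul_assoc]
    _ = eigenProj A a * B * (eigenProj A a * A) := by
        rw [mul_eigenProj, eigenProj_mul hA, mul_smul_comm, smul_mul_assoc, smul_mul_assoc]
    _ = _ := by simp only [mul_assoc]

theorem eq_sum_sum_eigenProj (hA : IsSelfAdjoint A) (T : H →L[ℂ] H) :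
    T = ∑ a ∈ specFinset A, ∑ b ∈ specFinset A, eigenProj A a * T * eigenProj A b := by
  simp only [← Finset.mul_sum, ← Finset.sum_mul, sum_eigenProj hA, one_mul, mul_one]

/-- The off-diagonal part of `B` is a commutator with `A`: the block of `Y` between the eigenspaces
for `a ≠ b` is that of `B` divided by `b - a`. -/
theorem exists_commutator_eq_pinching_sub (hA : IsSelfAdjoint A) (B : H →L[ℂ] H) :
    ∃ Y : H →L[ℂ] H, A * Y - Y * A = pinching A B - B := by
  -- For `a = b` the scalar is `0⁻¹ = 0`, so that the diagonal blocks of the witness vanish.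
  refine ⟨∑ a ∈ specFinset A, ∑ b ∈ specFinset A,
    (((b - a : ℝ) : ℂ)⁻¹) • (eigenProj A a * B * eigenProj A b), ?_⟩
  have hblock : ∀ a b : ℝ, A * (eigenProj A a * B * eigenProj A b)
      - eigenProj A a * B * eigenProj A b * A
      = ((a - b : ℝ) : ℂ) • (eigenProj A a * B * eigenProj A b) := by
    intro a b
    rw [← mul_assoc, ← mul_assoc, mul_eigenProj, mul_assoc _ _ A, eigenProj_mul hA]
    simp only [smul_mul_assoc, mul_smul_comm]
    rw [← sub_smul]
    push_cast
    rfl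
  conv_rhs => arg 2; rw [eq_sum_sum_eigenProj hA B]
  rw [pinching, ← Finset.sum_sub_distrib, Finset.mul_sum, Finset.sum_mul, ← Finset.sum_sub_distrib]
  refine Finset.sum_congr rfl fun a ha => ?_
  rw [Finset.mul_sum, Finset.sum_mul, ← Finset.sum_sub_distrib, ← Finset.add_sum_erase _ _ ha,
    ← Finset.add_sum_erase _ (fun b => eigenProj A a * B * eigenProj A b) ha]
  simp only [mul_smul_comm, smul_mul_assoc, ← smul_sub, hblock, sub_self]
  rw [← sub_sub, sub_self, zero_sub, Complex.ofReal_zero, zero_smul, smul_zero, zero_add,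
    ← Finset.sum_neg_distrib]
  refine Finset.sum_congr rfl fun b hb => ?_
  have hne : ((b - a : ℝ) : ℂ) ≠ 0 := by
    exact_mod_cast sub_ne_zero.2 (Finset.ne_of_mem_erase hb)
  rw [smul_smul, ← neg_sub b a, Complex.ofReal_neg, mul_neg, inv_mul_cancel₀ hne, neg_smul,
    one_smul]

/-- Commuting self-adjoint operators have a common orthonormal eigenbasis. -/
theorem exists_orthonormalBasis_of_commute {D : H →L[ℂ] H} (hA : IsSelfAdjoint A)
    (hD : IsSelfAdjoint D) (h : Commute A D) :
    ∃ (b : OrthonormalBasis (Fin (Module.finrank ℂ H)) ℂ H) (α δ : Fin (Module.finrank ℂ H) → ℂ),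
      (∀ i, A (b i) = α i • b i) ∧ ∀ i, D (b i) = δ i • b i := by
  classical
  have hAs : (A : H →ₗ[ℂ] H).IsSymmetric := hA.isSymmetric
  have hDs : (D : H →ₗ[ℂ] H).IsSymmetric := hD.isSymmetric
  have hc : Commute (A : H →ₗ[ℂ] H) (D : H →ₗ[ℂ] H) :=
    congrArg (fun T : H →L[ℂ] H => (T : H →ₗ[ℂ] H)) h.eq
  -- Only actual eigenvalues are used as indices: the joint eigenspaces must form a finite family.
  let ι := Module.End.Eigenvalues (D : H →ₗ[ℂ] H) × Module.End.Eigenvalues (A : H →ₗ[ℂ] H)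
  let f : ι → ℂ × ℂ := fun i => (i.1.1, i.2.1)
  have hf : Function.Injective f := fun i j hij =>
    Prod.ext (Subtype.ext (Prod.ext_iff.1 hij).1) (Subtype.ext (Prod.ext_iff.1 hij).2)
  have hO := (hAs.orthogonalFamily_eigenspace_inf_eigenspace hDs).comp hf
  have hI := hO.isInternal_iff.2 <| by
    rw [Submodule.orthogonal_eq_bot_iff, eq_top_iff,
      ← hAs.iSup_iSup_eigenspace_inf_eigenspace_eq_top_of_commute hDs hc]
    refine iSup_le fun α => iSup_le fun γ => ?_
    by_cases h1 : Module.End.HasEigenvalue (A : H →ₗ[ℂ] H) α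
    · by_cases h2 : Module.End.HasEigenvalue (D : H →ₗ[ℂ] H) γ
      · exact le_iSup (fun i : ι => Module.End.eigenspace (A : H →ₗ[ℂ] H) (f i).2 ⊓
          Module.End.eigenspace (D : H →ₗ[ℂ] H) (f i).1) (⟨γ, h2⟩, ⟨α, h1⟩)
      · rw [Module.End.hasEigenvalue_iff, not_not] at h2
        rw [h2, inf_bot_eq]
        exact bot_le
    · rw [Module.End.hasEigenvalue_iff, not_not] at h1
      rw [h1, bot_inf_eq]
      exact bot_le
  refine ⟨hI.subordinateOrthonormalBasis rfl hO,
    fun i => (f (hI.subordinateOrthonormalBasisIndex rfl i hO)).2,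
    fun i => (f (hI.subordinateOrthonormalBasisIndex rfl i hO)).1, fun i => ?_, fun i => ?_⟩
  · exact Module.End.mem_eigenspace_iff.1 (hI.subordinateOrthonormalBasis_subordinate rfl i hO).1
  · exact Module.End.mem_eigenspace_iff.1 (hI.subordinateOrthonormalBasis_subordinate rfl i hO).2

/-- In a common eigenbasis of `A` and of `pinching A B`, the latter is the diagonal part of `B`.
Hence `‖B - pinching A B‖` is one of the values over which `commutationNorm A B` is the supremum. -/
theorem norm_sub_pinching_le_commutationNorm (hA : IsSelfAdjoint A) (hB : IsSelfAdjoint B) :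
    ‖B - pinching A B‖ ≤ commutationNorm A B := by
  have hD := isSelfAdjoint_pinching A hB
  obtain ⟨b, α, δ, hα, hδ⟩ := exists_orthonormalBasis_of_commute hA hD (commute_pinching hA B)
  obtain ⟨Y, hY⟩ := exists_commutator_eq_pinching_sub hA B
  have hAs : (A : H →ₗ[ℂ] H).IsSymmetric := hA.isSymmetric
  have hinner : ∀ i v, ⟪b i, A v⟫_ℂ = α i * ⟪b i, v⟫_ℂ := by
    intro i v
    have hne : b i ≠ 0 := b.orthonormal.ne_zero i
    have hev : Module.End.HasEigenvalue (A : H →ₗ[ℂ] H) (α i) :=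
      Module.End.hasEigenvalue_of_hasEigenvector
        ⟨Module.End.mem_eigenspace_iff.2 (hα i), hne⟩
    have := hAs (b i) v
    simp only [ContinuousLinearMap.coe_coe] at this
    rw [← this, hα, inner_smul_left, hAs.conj_eigenvalue_eq_self hev]
  -- `pinching A B - B` is a commutator with `A`, so it has zero diagonal in a basis that
  -- diagonalizes `A`.
  have hdiag : ∀ i, ⟪b i, B (b i)⟫_ℂ = δ i := by
    intro i
    have h1 := congrArg (fun T : H →L[ℂ] H => ⟪b i, T (b i)⟫_ℂ) hY
    simp only [sub_apply, mul_apply_eq_comp, inner_sub_right, hinner, hα, map_smul,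
      inner_smul_right, hδ, sub_self, orthonormal_iff_ite.1 b.orthonormal i i, if_true,
      mul_one] at h1
    exact (sub_eq_zero.1 h1.symm).symm
  refine le_csSup (bddAbove_commutationValues A B) ⟨b, fun i => ?_, ?_⟩
  · ext v
    simp only [mul_apply_eq_comp, InnerProductSpace.rankOne_apply, map_smul, hα, hinner]
    rw [smul_smul, mul_comm]
  · congr 2
    refine ContinuousLinearMap.coe_injective (b.toBasis.ext fun j => ?_)
    simp only [OrthonormalBasis.coe_toBasis, ContinuousLinearMap.coe_coe, hδ,
      sum_apply, mul_apply_eq_comp, InnerProductSpace.rankOne_apply]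
    rw [Finset.sum_eq_single j]
    · simp [hdiag]
    · intro i _ hij
      simp [orthonormal_iff_ite.1 b.orthonormal i j, hij]
    · simp

end Pinching

/-! ### Perturbed-parametric unitaries -/

section Unitary

open Filter Topology

variable {H : Type*} [NormedAddCommGroup H] [InnerProductSpace ℂ H] [CompleteSpace H]
  {A B D : H →L[ℂ] H}

theorem two_pi_I_smul_mem_skewAdjoint {T : H →L[ℂ] H} (hT : IsSelfAdjoint T) :
    (2 * Real.pi * Complex.I : ℂ) • T ∈ skewAdjoint (H →L[ℂ] H) := by
  rw [skewAdjoint.mem_iff, star_smul, hT.star_eq, ← neg_smul]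
  congr 1
  simp

theorem isSelfAdjoint_smul_add (hA : IsSelfAdjoint A) (hB : IsSelfAdjoint B) (x : ℝ) :
    IsSelfAdjoint ((x : ℂ) • A + B) := by
  rw [IsSelfAdjoint, star_add, star_smul, hA.star_eq, hB.star_eq, RCLike.star_def,
    Complex.conj_ofReal]

theorem ppUnitary_mem_unitary (hA : IsSelfAdjoint A) (hB : IsSelfAdjoint B) (x : ℝ) :
    ppUnitary A B x ∈ unitary (H →L[ℂ] H) := by
  have h := two_pi_I_smul_mem_skewAdjoint (isSelfAdjoint_smul_add hA hB x)
  have h1 := exp_smul_mem_unitary h 1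
  rwa [one_smul] at h1

theorem star_ppUnitary (hA : IsSelfAdjoint A) (hB : IsSelfAdjoint B) (x : ℝ) :
    star (ppUnitary A B x) =
      NormedSpace.exp ((-(2 * Real.pi * Complex.I) : ℂ) • ((x : ℂ) • A + B)) := by
  rw [ppUnitary, NormedSpace.star_exp, star_smul, (isSelfAdjoint_smul_add hA hB x).star_eq]
  congr 2
  simp

theorem norm_ppUnitary_mul_sub_mul_le (hA : IsSelfAdjoint A) (hB : IsSelfAdjoint B)
    (hD : IsSelfAdjoint D) (x : ℝ) (w : H →L[ℂ] H) :
    ‖ppUnitary A B x * w - w * ppUnitary A D x‖ ≤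
      2 * Real.pi * ‖((x : ℂ) • A + B) * w - w * ((x : ℂ) • A + D)‖ := by
  have hB' := two_pi_I_smul_mem_skewAdjoint (isSelfAdjoint_smul_add hA hB x)
  have hD' := two_pi_I_smul_mem_skewAdjoint (isSelfAdjoint_smul_add hA hD x)
  refine (norm_exp_mul_sub_mul_exp_le hB' hD' w).trans_eq ?_
  rw [smul_mul_assoc, mul_smul_comm, ← smul_sub, norm_smul]
  congr 1
  simp [abs_of_pos Real.pi_pos]

theorem norm_ppUnitary_sub_le (hA : IsSelfAdjoint A) (hB : IsSelfAdjoint B)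
    (hD : IsSelfAdjoint D) (x : ℝ) :
    ‖ppUnitary A B x - ppUnitary A D x‖ ≤ 2 * Real.pi * ‖B - D‖ := by
  simpa using norm_ppUnitary_mul_sub_mul_le hA hB hD x 1

/-- If `[A, Y] = D - B`, then `W = x + Y` intertwines `xA + B` and `xA + D` up to the error
`BY - YD`, which does not depend on `x`. Duhamel's estimate for `W` bounds
`x (U - V) + (U Y - Y V)`. -/
theorem abs_mul_norm_ppUnitary_sub_le {Y : H →L[ℂ] H} (hA : IsSelfAdjoint A)
    (hB : IsSelfAdjoint B) (hD : IsSelfAdjoint D) (hY : A * Y - Y * A = D - B) (x : ℝ) :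
    |x| * ‖ppUnitary A B x - ppUnitary A D x‖ ≤ 2 * Real.pi * ‖B * Y - Y * D‖ + 2 * ‖Y‖ := by
  rcases eq_or_ne x 0 with rfl | hx
  · simp only [abs_zero, zero_mul]; positivity
  have hx' : (x : ℂ) ≠ 0 := by exact_mod_cast hx
  set U := ppUnitary A B x
  set V := ppUnitary A D x
  have h1 := norm_ppUnitary_mul_sub_mul_le hA hB hD x ((x : ℂ) • 1 + Y)
  have e1 : ((x : ℂ) • A + B) * ((x : ℂ) • 1 + Y) - ((x : ℂ) • 1 + Y) * ((x : ℂ) • A + D)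
      = B * Y - Y * D := by
    have : ((x : ℂ) • A + B) * ((x : ℂ) • 1 + Y) - ((x : ℂ) • 1 + Y) * ((x : ℂ) • A + D)
      = B * Y - Y * D + (x : ℂ) • ((A * Y - Y * A) - (D - B)) := by
      simp only [add_mul, mul_add, smul_mul_assoc, mul_smul_comm, one_mul, mul_one, smul_sub,
        smul_add]
      abel
    rw [this, hY, sub_self, smul_zero, add_zero]
  rw [e1] at h1
  have e2 : (x : ℂ) • (U - V)
      = (U * ((x : ℂ) • 1 + Y) - ((x : ℂ) • 1 + Y) * V) - (U * Y - Y * V) := by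
    simp only [add_mul, mul_add, smul_mul_assoc, mul_smul_comm, one_mul, mul_one, smul_sub]
    abel
  have h2 : ‖U * Y - Y * V‖ ≤ 2 * ‖Y‖ := by
    refine (norm_sub_le _ _).trans ?_
    rw [CStarRing.norm_mem_unitary_mul _ (ppUnitary_mem_unitary hA hB x),
      CStarRing.norm_mul_mem_unitary _ (ppUnitary_mem_unitary hA hD x)]
    linarith
  calc |x| * ‖U - V‖ = ‖(x : ℂ) • (U - V)‖ := by rw [norm_smul]; simp
    _ ≤ _ := by rw [e2]; exact (norm_sub_le _ _).trans (add_le_add h1 h2)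

theorem analyticAt_exp_smul_smul_add (c : ℂ) (A B : H →L[ℂ] H) (x : ℝ) :
    AnalyticAt ℝ (fun x : ℝ => NormedSpace.exp (c • ((x : ℂ) • A + B))) x := by
  refine (NormedSpace.exp_analytic (𝕂 := ℝ) _).comp
    (f := fun x : ℝ => c • ((x : ℂ) • A + B)) ?_
  have h : AnalyticAt ℝ (fun x : ℝ => (x : ℂ)) x := Complex.ofRealCLM.analyticAt x
  fun_prop

theorem analyticAt_ppUnitary (A B : H →L[ℂ] H) (x : ℝ) : AnalyticAt ℝ (ppUnitary A B) x :=
  analyticAt_exp_smul_smul_add _ A B x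

theorem continuous_ppUnitary (A B : H →L[ℂ] H) : Continuous (ppUnitary A B) :=
  continuous_iff_continuousAt.2 fun x => (analyticAt_ppUnitary A B x).continuousAt

theorem ppUnitary_eq_mul (h : Commute A D) (x : ℝ) :
    ppUnitary A D x = ppUnitary A D 0 *
      NormedSpace.exp ((2 * Real.pi * Complex.I * x : ℂ) • A) := by
  let : NormedAlgebra ℚ (H →L[ℂ] H) := NormedAlgebra.restrictScalars ℚ ℂ _
  rw [ppUnitary, ppUnitary, Complex.ofReal_zero, zero_smul, zero_add,
    ← NormedSpace.exp_add_of_commute ((h.symm.smul_left _).smul_right _), smul_add, smul_smul,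
    add_comm]

/-- On the eigenspace of `A` for `a`, the operator `e^{zA}` is multiplication by `e^{za}`. -/
theorem exp_smul_mul_eigenProj (A : H →L[ℂ] H) (z : ℂ) (a : ℝ) :
    NormedSpace.exp (z • A) * eigenProj A a = Complex.exp (z * a) • eigenProj A a := by
  let : NormedAlgebra ℚ (H →L[ℂ] H) := NormedAlgebra.restrictScalars ℚ ℂ _
  have h : SemiconjBy (eigenProj A a) (algebraMap ℂ (H →L[ℂ] H) (z * a)) (z • A) := by
    rw [SemiconjBy, smul_mul_assoc, mul_eigenProj, smul_smul, ← Algebra.commutes,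
      Algebra.smul_def]
  have h2 := h.exp_right
  rw [SemiconjBy, ← NormedSpace.algebraMap_exp_comm, ← Algebra.commutes, ← Algebra.smul_def] at h2
  rw [← h2, Complex.exp_eq_exp_ℂ]

theorem ppUnitary_mul_eigenProj (h : Commute A D) (x a : ℝ) :
    ppUnitary A D x * eigenProj A a =
      Complex.exp (2 * Real.pi * Complex.I * a * x) • (ppUnitary A D 0 * eigenProj A a) := by
  rw [ppUnitary_eq_mul h, mul_assoc, exp_smul_mul_eigenProj, mul_smul_comm]
  congr 2
  ring

theorem eq_zero_of_tendsto_exp_smul_sub {E : Type*} [NormedAddCommGroup E] [NormedSpace ℂ E]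
    {a b : ℝ} (hab : a ≠ b) {X Z : E}
    (h : Tendsto (fun x : ℝ => Complex.exp (2 * Real.pi * Complex.I * a * x) • X -
      Complex.exp (2 * Real.pi * Complex.I * b * x) • Z) atTop (𝓝 0)) : X = 0 := by
  have hne : ((a : ℂ) - b) ≠ 0 := by exact_mod_cast sub_ne_zero.2 hab
  set t : ℝ := (2 * (a - b))⁻¹ with ht
  set w : ℂ := Complex.exp (2 * Real.pi * Complex.I * b * t)
  have hw : ‖w‖ = 1 := by simp [w, Complex.norm_exp]
  -- A shift by `t` multiplies the second exponential by `w` and the first one by `-w`.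
  have key : ∀ x : ℝ, w • (Complex.exp (2 * Real.pi * Complex.I * a * x) • X -
      Complex.exp (2 * Real.pi * Complex.I * b * x) • Z) -
      (Complex.exp (2 * Real.pi * Complex.I * a * (x + t : ℝ)) • X -
        Complex.exp (2 * Real.pi * Complex.I * b * (x + t : ℝ)) • Z)
      = (2 * w * Complex.exp (2 * Real.pi * Complex.I * a * x)) • X := by
    intro x
    have h1 : Complex.exp (2 * Real.pi * Complex.I * a * (x + t : ℝ))
        = -(w * Complex.exp (2 * Real.pi * Complex.I * a * x)) := by
      have : (2 * Real.pi * Complex.I * a * (x + t : ℝ) : ℂ) = 2 * Real.pi * Complex.I * b * t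
          + 2 * Real.pi * Complex.I * a * x + Real.pi * Complex.I := by
        rw [ht]; push_cast; field_simp; ring
      rw [this, Complex.exp_add, Complex.exp_add, Complex.exp_pi_mul_I, mul_neg_one]
    have h2 : Complex.exp (2 * Real.pi * Complex.I * b * (x + t : ℝ))
        = w * Complex.exp (2 * Real.pi * Complex.I * b * x) := by
      rw [← Complex.exp_add]; congr 1; push_cast; ring
    rw [h1, h2]
    module
  have h3 := (h.const_smul w).sub (h.comp (tendsto_atTop_add_const_right atTop t tendsto_id))
  simp only [Function.comp, id, key, smul_zero, sub_zero] at h3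
  have h4 : Tendsto (fun _ : ℝ => 2 * ‖X‖) atTop (𝓝 0) := by
    simpa [norm_smul, hw, Complex.norm_exp] using h3.norm
  simpa using tendsto_nhds_unique tendsto_const_nhds h4

/-- Write `U` and `V` for the unitaries with the perturbations `B` and `D`. As `U` commutes with
`xA + B` and `V` with `xA + D`, the commutator `[V, B - D]` equals `[xA + B, U - V]`, which tends
to `0` as soon as `x (U - V)` does. -/
theorem tendsto_ppUnitary_commutator
    (hlim : Tendsto (fun x : ℝ => |x| * ‖ppUnitary A B x - ppUnitary A D x‖) atTop (𝓝 0)) :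
    Tendsto (fun x => ppUnitary A D x * (B - D) - (B - D) * ppUnitary A D x) atTop (𝓝 0) := by
  let : NormedAlgebra ℚ (H →L[ℂ] H) := NormedAlgebra.restrictScalars ℚ ℂ _
  have hcomm : ∀ (T : H →L[ℂ] H) (x : ℝ), Commute ((x : ℂ) • A + T) (ppUnitary A T x) :=
    fun T x => ((Commute.refl _).smul_right _).exp_right
  rw [tendsto_zero_iff_norm_tendsto_zero]
  have hlim' := hlim.mul_const (2 * (‖A‖ + ‖B‖))
  rw [zero_mul] at hlim'
  refine squeeze_zero' (.of_forall fun _ => norm_nonneg _) ?_ hlim'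
  filter_upwards [eventually_ge_atTop 1] with x hx
  set U := ppUnitary A B x
  set V := ppUnitary A D x
  have e : V * (B - D) - (B - D) * V
      = ((x : ℂ) • A + B) * (U - V) - (U - V) * ((x : ℂ) • A + B) := by
    have h1 : ((x : ℂ) • A + B) * U = U * ((x : ℂ) • A + B) := hcomm B x
    have h2 : ((x : ℂ) • A + D) * V = V * ((x : ℂ) • A + D) := hcomm D x
    have h3 : B - D = ((x : ℂ) • A + B) - ((x : ℂ) • A + D) := by abel
    rw [h3, mul_sub V, sub_mul _ _ V, mul_sub _ U, sub_mul U, h1, h2]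
    abel
  have hAB : ‖(x : ℂ) • A + B‖ ≤ |x| * (‖A‖ + ‖B‖) := by
    refine (norm_add_le _ _).trans ?_
    rw [norm_smul, mul_add]
    have : 1 ≤ |x| := hx.trans (le_abs_self x)
    have := mul_le_mul_of_nonneg_right this (norm_nonneg B)
    simp only [Complex.norm_real, Real.norm_eq_abs]
    linarith
  rw [e]
  calc _ ≤ ‖(x : ℂ) • A + B‖ * ‖U - V‖ + ‖U - V‖ * ‖(x : ℂ) • A + B‖ :=
        (norm_sub_le _ _).trans (add_le_add (norm_mul_le _ _) (norm_mul_le _ _))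
    _ = 2 * ‖(x : ℂ) • A + B‖ * ‖U - V‖ := by ring
    _ ≤ 2 * (|x| * (‖A‖ + ‖B‖)) * ‖U - V‖ := by gcongr
    _ = _ := by ring

theorem tendsto_ppUnitary_mul_exp_pow (hA : IsSelfAdjoint A) (hB : IsSelfAdjoint B) (x : ℝ) :
    Tendsto (fun n : ℕ => (ppUnitary A 0 ((n : ℝ)⁻¹ * x) *
      NormedSpace.exp ((n : ℝ)⁻¹ • (2 * Real.pi * Complex.I : ℂ) • B)) ^ n) atTop
      (𝓝 (ppUnitary A B x)) := by
  have hB' := two_pi_I_smul_mem_skewAdjoint hB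
  have hA' : (2 * Real.pi * Complex.I : ℂ) • ((x : ℂ) • A) ∈ skewAdjoint (H →L[ℂ] H) := by
    have hx : IsSelfAdjoint ((x : ℂ) • A) := by
      rw [IsSelfAdjoint, star_smul, hA.star_eq, RCLike.star_def, Complex.conj_ofReal]
    exact two_pi_I_smul_mem_skewAdjoint hx
  have h := tendsto_exp_mul_exp_pow hA' hB'
  rw [ppUnitary, smul_add]
  refine h.congr fun n => ?_
  rw [ppUnitary, add_zero]
  congr 3
  rw [← Complex.coe_smul, smul_smul, smul_smul, smul_smul]
  congr 1
  push_cast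
  ring

end Unitary

section Commuting

open Filter Topology

variable {H : Type*} [NormedAddCommGroup H] [InnerProductSpace ℂ H] [CompleteSpace H]
  [FiniteDimensional ℂ H] {A B D : H →L[ℂ] H}

theorem ppUnitary_eq_sum (hA : IsSelfAdjoint A) (h : Commute A D) (x : ℝ) :
    ppUnitary A D x = ∑ a ∈ specFinset A, Complex.exp (2 * Real.pi * Complex.I * a * x) •
      (ppUnitary A D 0 * eigenProj A a) := by
  simp only [← ppUnitary_mul_eigenProj h, ← Finset.mul_sum, sum_eigenProj hA, mul_one]

theorem ppUnitary_mem_trigPoly (hA : IsSelfAdjoint A) (h : Commute A D) :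
    ppUnitary A D ∈ trigPoly (H →L[ℂ] H) (Spec A) := by
  have e : ppUnitary A D = ∑ a ∈ specFinset A, fun x : ℝ =>
      Complex.exp (2 * Real.pi * Complex.I * a * x) • (ppUnitary A D 0 * eigenProj A a) := by
    ext1 x
    rw [ppUnitary_eq_sum hA h, Finset.sum_apply]
  rw [e]
  exact Submodule.sum_mem _ fun a ha => exp_smul_mem_trigPoly (by rwa [← coe_specFinset]) _

/-- The block of `[V, B - pinching A B] → 0` between the eigenspaces for `a ≠ b` is a combination of
the two exponentials `e^{2πiax}` and `e^{2πibx}`, so its coefficients vanish; hence every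
off-diagonal block of `B` is zero. -/
theorem commute_of_tendsto (hA : IsSelfAdjoint A) (hB : IsSelfAdjoint B)
    (hlim : Tendsto (fun x : ℝ => |x| * ‖ppUnitary A B x - ppUnitary A (pinching A B) x‖)
      atTop (𝓝 0)) : Commute A B := by
  let : NormedAlgebra ℚ (H →L[ℂ] H) := NormedAlgebra.restrictScalars ℚ ℂ _
  set D := pinching A B with hDdef
  have hAD : Commute A D := commute_pinching hA B
  have hD : IsSelfAdjoint D := isSelfAdjoint_pinching A hB
  have hT := tendsto_ppUnitary_commutator hlim
  suffices hN : B - D = 0 by rw [sub_eq_zero.1 hN]; exact hAD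
  rw [eq_sum_sum_eigenProj hA (B - D)]
  refine Finset.sum_eq_zero fun a ha => Finset.sum_eq_zero fun b hb => ?_
  have hPD := commute_eigenProj_pinching hA B ha
  rcases eq_or_ne a b with rfl | hab
  · rw [mul_sub, sub_mul, eigenProj_mul_pinching hA B ha, mul_assoc _ (eigenProj A a),
      eigenProj_mul_self, sub_self]
  have hcomm : ∀ x : ℝ, Commute (eigenProj A a) (ppUnitary A D x) := by
    intro x
    refine Commute.exp_right (Commute.smul_right (Commute.add_right (Commute.smul_right ?_ _)
      hPD) _)
    exact (eigenProj_mul hA a).trans (mul_eigenProj A a).symm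
  have hX : ppUnitary A D 0 * eigenProj A a * (B - D) * eigenProj A b = 0 := by
    refine eq_zero_of_tendsto_exp_smul_sub hab
      (Z := eigenProj A a * (B - D) * (ppUnitary A D 0 * eigenProj A b)) ?_
    have h1 := (hT.const_mul (eigenProj A a)).mul_const (eigenProj A b)
    rw [mul_zero, zero_mul] at h1
    refine h1.congr fun x => ?_
    calc eigenProj A a * (ppUnitary A D x * (B - D) - (B - D) * ppUnitary A D x) * eigenProj A b
        = (eigenProj A a * ppUnitary A D x) * (B - D) * eigenProj A b
          - eigenProj A a * (B - D) * (ppUnitary A D x * eigenProj A b) := by noncomm_ring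
      _ = _ := by
          rw [(hcomm x).eq, ppUnitary_mul_eigenProj hAD x a, ppUnitary_mul_eigenProj hAD x b,
            smul_mul_assoc, smul_mul_assoc, mul_smul_comm]
  have hu := Unitary.star_mul_self_of_mem (ppUnitary_mem_unitary hA hD 0)
  calc eigenProj A a * (B - D) * eigenProj A b
      = (star (ppUnitary A D 0) * ppUnitary A D 0) * (eigenProj A a * (B - D) * eigenProj A b) := by
        rw [hu, one_mul]
    _ = star (ppUnitary A D 0) * (ppUnitary A D 0 * eigenProj A a * (B - D) * eigenProj A b) := by
        simp only [mul_assoc]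
    _ = 0 := by rw [hX, mul_zero]

end Commuting

/-! ### Expectation-value functions -/

section ExpectationValue

open Filter Topology

variable {H : Type*} [NormedAddCommGroup H] [InnerProductSpace ℂ H] [FiniteDimensional ℂ H]

/-- The trace as a continuous linear functional on operators. -/
noncomputable def traceCLM (H : Type*) [NormedAddCommGroup H] [InnerProductSpace ℂ H]
    [FiniteDimensional ℂ H] : (H →L[ℂ] H) →L[ℂ] ℂ :=
  LinearMap.toContinuousLinearMap (LinearMap.trace ℂ H ∘ₗ ContinuousLinearMap.coeLM ℂ)

theorem traceCLM_apply (T : H →L[ℂ] H) :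
    traceCLM H T = LinearMap.trace ℂ H (T : H →ₗ[ℂ] H) := rfl

theorem traceCLM_mul_comm (S T : H →L[ℂ] H) : traceCLM H (S * T) = traceCLM H (T * S) :=
  LinearMap.trace_mul_comm ℂ _ _

variable [CompleteSpace H] {A B D M ρ : H →L[ℂ] H}

theorem star_traceCLM (T : H →L[ℂ] H) : star (traceCLM H T) = traceCLM H (star T) := by
  rw [traceCLM_apply, traceCLM_apply, LinearMap.trace_eq_sum_inner _ (stdOrthonormalBasis ℂ H),
    LinearMap.trace_eq_sum_inner _ (stdOrthonormalBasis ℂ H), star_sum]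
  refine Finset.sum_congr rfl fun i _ => ?_
  simp only [ContinuousLinearMap.coe_coe, ContinuousLinearMap.star_eq_adjoint]
  rw [ContinuousLinearMap.adjoint_inner_right]
  exact inner_conj_symm _ _

theorem evf_eq_traceCLM (hA : IsSelfAdjoint A) (hB : IsSelfAdjoint B) (hM : IsSelfAdjoint M)
    (hρ : IsSelfAdjoint ρ) (x : ℝ) :
    (evf A B M ρ x : ℂ) = traceCLM H (M * ppUnitary A B x * ρ * star (ppUnitary A B x)) := by
  rw [coe_evf hA hB hM hρ, star_ppUnitary hA hB, traceCLM_apply]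

theorem norm_traceCLM_conj_le {U : H →L[ℂ] H} (hU : U ∈ unitary (H →L[ℂ] H)) :
    ‖traceCLM H (M * U * ρ * star U)‖ ≤ ‖traceCLM H‖ * (‖M‖ * ‖ρ‖) := by
  refine ((traceCLM H).le_opNorm _).trans (mul_le_mul_of_nonneg_left ?_ (norm_nonneg _))
  rw [CStarRing.norm_mul_mem_unitary _ (Unitary.star_mem hU)]
  refine (norm_mul_le _ _).trans ?_
  rw [CStarRing.norm_mul_mem_unitary _ hU]

theorem norm_traceCLM_conj_sub_le {U V : H →L[ℂ] H} (hU : U ∈ unitary (H →L[ℂ] H))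
    (hV : V ∈ unitary (H →L[ℂ] H)) :
    ‖traceCLM H (M * U * ρ * star U) - traceCLM H (M * V * ρ * star V)‖ ≤
      2 * (‖traceCLM H‖ * ‖M‖ * ‖ρ‖) * ‖U - V‖ := by
  have e : M * U * ρ * star U - M * V * ρ * star V
      = M * (U - V) * ρ * star U + M * V * (ρ * star (U - V)) := by
    rw [star_sub]; noncomm_ring
  have h1 : ‖M * (U - V) * ρ * star U‖ ≤ ‖M‖ * ‖U - V‖ * ‖ρ‖ := by
    rw [CStarRing.norm_mul_mem_unitary _ (Unitary.star_mem hU)]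
    exact (norm_mul_le _ _).trans
      (mul_le_mul_of_nonneg_right (norm_mul_le _ _) (norm_nonneg _))
  have h2 : ‖M * V * (ρ * star (U - V))‖ ≤ ‖M‖ * (‖ρ‖ * ‖U - V‖) := by
    refine (norm_mul_le _ _).trans ?_
    rw [CStarRing.norm_mul_mem_unitary _ hV]
    refine mul_le_mul_of_nonneg_left ?_ (norm_nonneg _)
    exact (norm_mul_le _ _).trans_eq (by rw [norm_star])
  rw [← map_sub, e]
  calc _ ≤ ‖traceCLM H‖ * (‖M‖ * ‖U - V‖ * ‖ρ‖ + ‖M‖ * (‖ρ‖ * ‖U - V‖)) :=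
        ((traceCLM H).le_opNorm _).trans (mul_le_mul_of_nonneg_left
          ((norm_add_le _ _).trans (add_le_add h1 h2)) (norm_nonneg _))
    _ = _ := by ring

theorem analyticAt_evf (A B M ρ : H →L[ℂ] H) (x : ℝ) : AnalyticAt ℝ (evf A B M ρ) x := by
  have h := ((analyticAt_const (v := M)).mul (analyticAt_ppUnitary A B x)).mul
    (analyticAt_const (v := ρ)) |>.mul
    (analyticAt_exp_smul_smul_add (-(2 * Real.pi * Complex.I)) A B x)
  exact ((Complex.reCLM.comp ((traceCLM H).restrictScalars ℝ)).analyticAt _).comp h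

theorem abs_evf_le (hA : IsSelfAdjoint A) (hB : IsSelfAdjoint B) (hM : IsSelfAdjoint M)
    (hρ : IsSelfAdjoint ρ) (x : ℝ) : |evf A B M ρ x| ≤ ‖traceCLM H‖ * (‖M‖ * ‖ρ‖) := by
  rw [← Real.norm_eq_abs, ← Complex.norm_real, evf_eq_traceCLM hA hB hM hρ]
  exact norm_traceCLM_conj_le (ppUnitary_mem_unitary hA hB x)

theorem linearDecay_ppUnitary_sub (hA : IsSelfAdjoint A) (hB : IsSelfAdjoint B) :
    LinearDecay fun x => ppUnitary A B x - ppUnitary A (pinching A B) x := by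
  obtain ⟨Y, hY⟩ := exists_commutator_eq_pinching_sub hA B
  exact ⟨(continuous_ppUnitary _ _).sub (continuous_ppUnitary _ _), 0, _, le_rfl, by positivity,
    fun x _ => abs_mul_norm_ppUnitary_sub_le hA hB (isSelfAdjoint_pinching A hB) hY x⟩

theorem linearDecay_evf_sub (hA : IsSelfAdjoint A) (hB : IsSelfAdjoint B) (hM : IsSelfAdjoint M)
    (hρ : IsSelfAdjoint ρ) : LinearDecay (evf A B M ρ - evf A (pinching A B) M ρ) := by
  have hD := isSelfAdjoint_pinching A hB
  obtain ⟨-, c, C, hc, hC, h⟩ := linearDecay_ppUnitary_sub hA hB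
  refine ⟨continuous_iff_continuousAt.2 fun x => (analyticAt_evf A B M ρ x).continuousAt.sub
    (analyticAt_evf A _ M ρ x).continuousAt, c, 2 * (‖traceCLM H‖ * ‖M‖ * ‖ρ‖) * C, hc,
    by positivity, fun x hx => ?_⟩
  rw [Pi.sub_apply, ← Complex.norm_real, Complex.ofReal_sub, evf_eq_traceCLM hA hB hM hρ,
    evf_eq_traceCLM hA hD hM hρ]
  calc _ ≤ |x| * (2 * (‖traceCLM H‖ * ‖M‖ * ‖ρ‖) *
          ‖ppUnitary A B x - ppUnitary A (pinching A B) x‖) :=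
        mul_le_mul_of_nonneg_left (norm_traceCLM_conj_sub_le (ppUnitary_mem_unitary hA hB x)
          (ppUnitary_mem_unitary hA hD x)) (abs_nonneg x)
    _ = 2 * (‖traceCLM H‖ * ‖M‖ * ‖ρ‖) *
          (|x| * ‖ppUnitary A B x - ppUnitary A (pinching A B) x‖) := by ring
    _ ≤ _ := mul_le_mul_of_nonneg_left (h x hx) (by positivity)

theorem traceCLM_conj_mem_trigPoly {S R : Set ℝ} (h : ∀ s ∈ S, ∀ t ∈ S, s - t ∈ R)
    {F : ℝ → H →L[ℂ] H} (hF : F ∈ trigPoly (H →L[ℂ] H) S) :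
    (fun x => traceCLM H (M * F x * ρ * star (F x))) ∈ trigPoly ℂ R := by
  have h0 : ∀ T : H →L[ℂ] H, (fun _ : ℝ => T) ∈ trigPoly (H →L[ℂ] H) {0} := fun T =>
    const_mem_trigPoly (Set.mem_singleton _) T
  have h1 : (fun _ : ℝ => M) * F ∈ trigPoly (H →L[ℂ] H) S :=
    mul_mem_trigPoly (fun s hs t ht => by rw [Set.mem_singleton_iff.1 hs, zero_add]; exact ht)
      (h0 M) hF
  have h2 : (fun _ : ℝ => M) * F * (fun _ : ℝ => ρ) ∈ trigPoly (H →L[ℂ] H) S :=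
    mul_mem_trigPoly (fun s hs t ht => by rw [Set.mem_singleton_iff.1 ht, add_zero]; exact hs)
      h1 (h0 ρ)
  have h3 : star F ∈ trigPoly (H →L[ℂ] H) {t | -t ∈ S} :=
    star_mem_trigPoly (fun s hs => by simpa using hs) hF
  exact comp_mem_trigPoly (traceCLM H) (mul_mem_trigPoly
    (fun s hs t ht => by simpa using h s hs (-t) ht) h2 h3)

theorem Spec_subset_Icc (A : H →L[ℂ] H) : Spec A ⊆ Set.Icc (eigMin A) (eigMax A) := fun _ ha =>
  ⟨csInf_le (finite_Spec A).bddBelow ha, le_csSup (finite_Spec A).bddAbove ha⟩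

theorem ppUnitary_zero_mul_mem_trigPoly (hA : IsSelfAdjoint A) {r : ℝ} (hr : 0 ≤ r) :
    (fun x : ℝ => ppUnitary A 0 (r * x)) ∈ trigPoly (H →L[ℂ] H)
      (Set.Icc (r * eigMin A) (r * eigMax A)) := by
  have e : (fun x : ℝ => ppUnitary A 0 (r * x)) = ∑ a ∈ specFinset A, fun x : ℝ =>
      Complex.exp (2 * Real.pi * Complex.I * (r * a : ℝ) * x) •
        (ppUnitary A 0 0 * eigenProj A a) := by
    ext1 x
    rw [ppUnitary_eq_sum hA (Commute.zero_right A), Finset.sum_apply]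
    refine Finset.sum_congr rfl fun a _ => ?_
    congr 2
    push_cast
    ring
  rw [e]
  refine Submodule.sum_mem _ fun a ha => exp_smul_mem_trigPoly ?_ _
  have := Spec_subset_Icc A (coe_specFinset A ▸ ha : a ∈ Spec A)
  exact ⟨mul_le_mul_of_nonneg_left this.1 hr, mul_le_mul_of_nonneg_left this.2 hr⟩

/-- The Lie–Trotter products `(e^{2πixA/n} e^{2πiB/n})ⁿ` are trigonometric polynomials in `x`. Their
frequencies are means of `n` eigenvalues of `A`, so they lie between the extreme eigenvalues. -/
theorem exists_tendsto_ppUnitary_of_trigPoly (hA : IsSelfAdjoint A) (hB : IsSelfAdjoint B) :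
    ∃ F : ℕ → ℝ → H →L[ℂ] H,
      (∀ n, F n ∈ trigPoly (H →L[ℂ] H) (Set.Icc (eigMin A) (eigMax A))) ∧
      (∀ n x, F n x ∈ unitary (H →L[ℂ] H)) ∧
      ∀ x, Tendsto (fun n => F n x) atTop (𝓝 (ppUnitary A B x)) := by
  have hB' := two_pi_I_smul_mem_skewAdjoint hB
  -- The index is shifted: the empty product has frequency `0`, which may lie outside the interval.
  refine ⟨fun n => (fun x => ppUnitary A 0 (((n + 1 : ℕ) : ℝ)⁻¹ * x) *
    NormedSpace.exp (((n + 1 : ℕ) : ℝ)⁻¹ • (2 * Real.pi * Complex.I : ℂ) • B)) ^ (n + 1),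
    fun n => ?_, fun n x => ?_, fun x => ?_⟩
  · have hn : (0 : ℝ) < (n + 1 : ℕ) := by positivity
    have h1 := ppUnitary_zero_mul_mem_trigPoly hA (inv_nonneg.2 hn.le)
    have h2 := mul_mem_trigPoly (T := {0}) (fun s hs t ht => by
        rw [Set.mem_singleton_iff.1 ht, add_zero]; exact hs) h1
      (const_mem_trigPoly (Set.mem_singleton _)
        (NormedSpace.exp (((n + 1 : ℕ) : ℝ)⁻¹ • (2 * Real.pi * Complex.I : ℂ) • B)))
    have h3 := pow_mem_trigPoly h2 (n + 1)
    rwa [mul_inv_cancel_left₀ hn.ne', mul_inv_cancel_left₀ hn.ne'] at h3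
  · have h1 := ppUnitary_mem_unitary hA (IsSelfAdjoint.zero (H →L[ℂ] H))
      (((n + 1 : ℕ) : ℝ)⁻¹ * x)
    have h2 := exp_smul_mem_unitary hB' ((n + 1 : ℕ) : ℝ)⁻¹
    exact Submonoid.pow_mem _ (Submonoid.mul_mem _ h1 h2) (n + 1)
  · exact (tendsto_ppUnitary_mul_exp_pow hA hB x).comp (tendsto_add_atTop_nat 1)

/-- The expectation-value function is a bounded pointwise limit of trigonometric polynomials whose
frequencies are differences of two numbers between the extreme eigenvalues of `A`. -/
theorem hasSpectrumIn_evf (hA : IsSelfAdjoint A) (hB : IsSelfAdjoint B) (hM : IsSelfAdjoint M)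
    (hρ : IsSelfAdjoint ρ) : HasSpectrumIn (fun x => (evf A B M ρ x : ℂ))
      (Set.Icc (eigMin A - eigMax A) (eigMax A - eigMin A)) := by
  obtain ⟨F, hF, hu, hlim⟩ := exists_tendsto_ppUnitary_of_trigPoly hA hB
  refine hasSpectrumIn_of_tendsto isClosed_Icc
    (F := fun n x => traceCLM H (M * F n x * ρ * star (F n x)))
    (fun n => traceCLM_conj_mem_trigPoly (fun s hs t ht => ?_) (hF n))
    (fun n x => norm_traceCLM_conj_le (hu n x))
    (Complex.continuous_ofReal.comp
      (continuous_iff_continuousAt.2 fun x => (analyticAt_evf A B M ρ x).continuousAt)) fun x => ?_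
  · exact ⟨sub_le_sub hs.1 ht.2, sub_le_sub hs.2 ht.1⟩
  · rw [evf_eq_traceCLM hA hB hM hρ]
    exact ((traceCLM H).continuous.tendsto _).comp
      ((((hlim x).const_mul M).mul_const ρ).mul (hlim x).star)

theorem finite_diffSet_Spec (A : H →L[ℂ] H) : (diffSet (Spec A)).Finite :=
  ((finite_Spec A).image2 (fun a b => a - b) (finite_Spec A)).subset <| by
    rintro _ ⟨a, ha, b, hb, rfl⟩
    exact ⟨a, ha, b, hb, rfl⟩

theorem sSup_diffSet_Spec [Nontrivial H] (hA : IsSelfAdjoint A) :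
    sSup (diffSet (Spec A)) = eigMax A - eigMin A := by
  have hmax : eigMax A ∈ Spec A := (Spec_nonempty hA).csSup_mem (finite_Spec A)
  have hmin : eigMin A ∈ Spec A := (Spec_nonempty hA).csInf_mem (finite_Spec A)
  have hmem : eigMax A - eigMin A ∈ diffSet (Spec A) := ⟨_, hmax, _, hmin, rfl⟩
  refine le_antisymm (csSup_le ⟨_, hmem⟩ ?_) (le_csSup (finite_diffSet_Spec A).bddAbove hmem)
  rintro _ ⟨a, ha, b, hb, rfl⟩
  exact sub_le_sub (Spec_subset_Icc A ha).2 (Spec_subset_Icc A hb).1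

theorem evf_mem_KSpace_of_commute (hA : IsSelfAdjoint A) (hD : IsSelfAdjoint D)
    (hM : IsSelfAdjoint M) (hρ : IsSelfAdjoint ρ) (h : Commute A D) :
    evf A D M ρ ∈ KSpace (diffSet (Spec A)) := by
  refine ⟨?_, ⟨_, abs_evf_le hA hD hM hρ⟩, ?_⟩
  · rw [← contDiffOn_univ]
    exact AnalyticOnNhd.contDiffOn (fun x _ => analyticAt_evf A D M ρ x) uniqueDiffOn_univ
  · simp only [evf_eq_traceCLM hA hD hM hρ]
    exact hasSpectrumIn_of_mem_trigPoly (finite_diffSet_Spec A).isClosed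
      (traceCLM_conj_mem_trigPoly (R := diffSet (Spec A)) (fun s hs t ht => ⟨s, hs, t, ht, rfl⟩)
        (ppUnitary_mem_trigPoly hA h))

theorem evf_sub_mem_DecaySpace [Nontrivial H] (hA : IsSelfAdjoint A) (hB : IsSelfAdjoint B)
    (hM : IsSelfAdjoint M) (hρ : IsSelfAdjoint ρ) :
    evf A B M ρ - evf A (pinching A B) M ρ ∈ DecaySpace (sSup (diffSet (Spec A))) := by
  have hD := isSelfAdjoint_pinching A hB
  refine ⟨fun x => (analyticAt_evf A B M ρ x).sub (analyticAt_evf A _ M ρ x),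
    linearDecay_evf_sub hA hB hM hρ, ?_⟩
  rw [sSup_diffSet_Spec hA, neg_sub]
  convert (hasSpectrumIn_evf hA hB hM hρ).add
    ((hasSpectrumIn_evf hA hD hM hρ).smul (-1)) using 1
  ext x
  simp [sub_eq_add_neg]

/-- When `D` commutes with `A`, the unitary is the sum of the `e^{2πiax} C_a`, and the coefficient
of `e^{2πiξx}` in the expectation value is the sum of `tr (M C_a ρ C_b*)` over the pairs `(a, b)`
with `a - b = ξ`. Exchanging `a` and `b` conjugates this trace. -/
theorem exists_evf_eq_sum_of_commute (hA : IsSelfAdjoint A) (hD : IsSelfAdjoint D)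
    (hM : IsSelfAdjoint M) (hρ : IsSelfAdjoint ρ) (h : Commute A D) :
    ∃ (s : Finset ℝ) (c : ℝ → ℂ), (s : Set ℝ) = diffSet (Spec A) ∧
      (∀ ξ ∈ s, c (-ξ) = star (c ξ)) ∧
      ∀ x : ℝ, (evf A D M ρ x : ℂ) =
        ∑ ξ ∈ s, c ξ * Complex.exp (2 * Real.pi * Complex.I * ξ * x) := by
  classical
  set E := ppUnitary A D 0
  set σ := specFinset A with hσ
  let t : ℝ × ℝ → ℂ := fun p =>
    traceCLM H (M * (E * eigenProj A p.1) * ρ * star (E * eigenProj A p.2))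
  have ht : ∀ p, star (t p) = t p.swap := by
    intro p
    simp only [t, star_traceCLM, Prod.fst_swap, Prod.snd_swap]
    rw [star_mul, star_star, star_mul, star_mul M, hM.star_eq, hρ.star_eq, ← mul_assoc,
      ← mul_assoc, traceCLM_mul_comm]
    simp only [mul_assoc]
  refine ⟨(σ ×ˢ σ).image fun p => p.1 - p.2,
    fun ξ => ∑ p ∈ σ ×ˢ σ with p.1 - p.2 = ξ, t p, ?_, fun ξ _ => ?_, fun x => ?_⟩
  · ext d
    simp only [Finset.coe_image, Set.mem_image, Finset.mem_coe, Finset.mem_product, diffSet,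
      ← coe_specFinset A, ← hσ]
    constructor
    · rintro ⟨p, ⟨h1, h2⟩, rfl⟩
      exact ⟨p.1, h1, p.2, h2, rfl⟩
    · rintro ⟨a, ha, b, hb, rfl⟩
      exact ⟨(a, b), ⟨ha, hb⟩, rfl⟩
  · rw [star_sum]
    refine Finset.sum_nbij' Prod.swap Prod.swap ?_ ?_ ?_ ?_ ?_
    · intro p hp
      simp only [Finset.mem_filter, Finset.mem_product, Prod.fst_swap, Prod.snd_swap] at hp ⊢
      exact ⟨hp.1.symm, by linarith [hp.2]⟩
    · intro p hp
      simp only [Finset.mem_filter, Finset.mem_product, Prod.fst_swap, Prod.snd_swap] at hp ⊢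
      exact ⟨hp.1.symm, by linarith [hp.2]⟩
    · simp
    · simp
    · intro p _
      rw [ht, Prod.swap_swap]
  · have h1 : (evf A D M ρ x : ℂ) = ∑ p ∈ σ ×ˢ σ,
        t p * Complex.exp (2 * Real.pi * Complex.I * (p.1 - p.2 : ℝ) * x) := by
      rw [evf_eq_traceCLM hA hD hM hρ, ppUnitary_eq_sum hA h x, star_sum, Finset.mul_sum,
        map_sum, Finset.sum_product_right]
      refine Finset.sum_congr rfl fun b _ => ?_
      rw [Finset.mul_sum, Finset.sum_mul, Finset.sum_mul, map_sum]
      refine Finset.sum_congr rfl fun a _ => ?_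
      rw [star_smul, mul_smul_comm, mul_smul_comm, smul_mul_assoc, smul_mul_assoc, smul_smul,
        map_smul, smul_eq_mul, mul_comm]
      congr 1
      rw [RCLike.star_def, ← Complex.exp_conj, ← Complex.exp_add]
      congr 1
      simp [map_ofNat]
      ring
    rw [h1, ← Finset.sum_fiberwise_of_maps_to (g := fun p : ℝ × ℝ => p.1 - p.2)
      fun p hp => Finset.mem_image_of_mem _ hp]
    refine Finset.sum_congr rfl fun ξ _ => ?_
    rw [Finset.sum_mul]
    refine Finset.sum_congr rfl fun p hp => ?_
    rw [(Finset.mem_filter.1 hp).2]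

end ExpectationValue

theorem LinearDecay.sub {F : Type*} [NormedAddCommGroup F] {f g : ℝ → F} (hf : LinearDecay f)
    (hg : LinearDecay g) : LinearDecay (f - g) := by
  obtain ⟨hfc, c, C, hc, hC, h⟩ := hf
  obtain ⟨hgc, d, D, hd, hD, h'⟩ := hg
  refine ⟨hfc.sub hgc, max c d, C + D, le_max_of_le_left hc, add_nonneg hC hD, fun x hx => ?_⟩
  calc |x| * ‖f x - g x‖ ≤ |x| * (‖f x‖ + ‖g x‖) :=
        mul_le_mul_of_nonneg_left (norm_sub_le _ _) (abs_nonneg x)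
    _ = |x| * ‖f x‖ + |x| * ‖g x‖ := mul_add _ _ _
    _ ≤ C + D := add_le_add (h x ((le_max_left _ _).trans hx)) (h' x ((le_max_right _ _).trans hx))

theorem LinearDecay.ofReal {f : ℝ → ℝ} (hf : LinearDecay f) :
    LinearDecay fun x => (f x : ℂ) := by
  obtain ⟨hfc, c, C, hc, hC, h⟩ := hf
  exact ⟨Complex.continuous_ofReal.comp hfc, c, C, hc, hC, by simpa using h⟩

/-- This gives both the directness of the sum and the uniqueness of the decomposition. -/
theorem eq_zero_of_mem_KSpace_of_linearDecay {S : Set ℝ} (hS : S.Finite) {f : ℝ → ℝ}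
    (hf : f ∈ KSpace S) (hd : LinearDecay f) : f = 0 := by
  have h := hd.ofReal.eq_zero_of_hasSpectrumIn hf.2.2 (hS.measure_zero _)
  ext x
  simpa using congrFun h x

end PerturbedParametric

open PerturbedParametric
theorem mainTheorem6 {H : Type*} [NormedAddCommGroup H] [InnerProductSpace ℂ H]
    [FiniteDimensional ℂ H] [CompleteSpace H] (A B : H →L[ℂ] H)
    (hA : IsSelfAdjoint A) (hB : IsSelfAdjoint B)
    (hAscalar : ∀ c : ℂ, A ≠ c • (1 : H →L[ℂ] H)) :
    (∃ V : ℝ → H →L[ℂ] H,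
      (∀ x, V x ∈ unitary (H →L[ℂ] H)) ∧
      V ∈ KOp (Spec A) ∧
      (∃ (s : Finset ℝ) (C : ℝ → H →L[ℂ] H), (s : Set ℝ) = Spec A ∧
        ∀ x : ℝ, V x = ∑ a ∈ s, Complex.exp (2 * Real.pi * Complex.I * a * x) • C a) ∧
      LinearDecay (fun x => ppUnitary A B x - V x) ∧
      (Filter.Tendsto (fun x : ℝ => |x| * ‖ppUnitary A B x - V x‖) Filter.atTop (nhds 0) →
        Commute A B) ∧
      (∀ x : ℝ, ‖ppUnitary A B x - V x‖ ≤ 2 * Real.pi * commutationNorm A B)) ∧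
    Disjoint (KSpace (diffSet (Spec A))) (DecaySpace (sSup (diffSet (Spec A)))) ∧
    ∀ M ρ : H →L[ℂ] H, IsSelfAdjoint M → ρ.IsPositive →
      evf A B M ρ ∈ KSpace (diffSet (Spec A)) ⊔ DecaySpace (sSup (diffSet (Spec A))) ∧
      ∃ f₁ f₀ : ℝ → ℝ,
        f₁ ∈ KSpace (diffSet (Spec A)) ∧
        f₀ ∈ DecaySpace (sSup (diffSet (Spec A))) ∧
        evf A B M ρ = f₁ + f₀ ∧
        (∃ (s : Finset ℝ) (c : ℝ → ℂ), (s : Set ℝ) = diffSet (Spec A) ∧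
          (∀ ξ ∈ s, c (-ξ) = star (c ξ)) ∧
          ∀ x : ℝ, (f₁ x : ℂ) = ∑ ξ ∈ s, c ξ * Complex.exp (2 * Real.pi * Complex.I * ξ * x)) ∧
        (∃ h : MeasureTheory.MemLp (fun x => (f₀ x : ℂ)) 2 MeasureTheory.volume,
          ∀ᵐ ξ : ℝ, ξ ∉ Set.Icc (eigMin A - eigMax A) (eigMax A - eigMin A) →
            (FourierTransform.fourier (h.toLp (fun x => (f₀ x : ℂ))) :
              MeasureTheory.Lp ℂ 2 (MeasureTheory.volume : MeasureTheory.Measure ℝ)) ξ = 0) ∧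
        (∀ g₁ g₀ : ℝ → ℝ, g₁ ∈ KSpace (diffSet (Spec A)) → LinearDecay g₀ →
          evf A B M ρ = g₁ + g₀ → g₁ = f₁ ∧ g₀ = f₀) := by
  have hH : Nontrivial H := by
    by_contra hn
    rw [not_nontrivial_iff_subsingleton] at hn
    exact hAscalar 0 (Subsingleton.elim _ _)
  have hD := isSelfAdjoint_pinching A hB
  have hAD := commute_pinching hA B
  have htrig := ppUnitary_mem_trigPoly hA hAD
  have hfin := finite_diffSet_Spec A
  refine ⟨⟨ppUnitary A (pinching A B), ppUnitary_mem_unitary hA hD,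
    ⟨continuous_ppUnitary _ _, exists_norm_le_of_mem_trigPoly htrig,
      hasSpectrumIn_of_mem_trigPoly (finite_Spec A).isClosed htrig⟩,
    ⟨_, _, coe_specFinset A, ppUnitary_eq_sum hA hAD⟩, linearDecay_ppUnitary_sub hA hB,
    commute_of_tendsto hA hB, fun x => (norm_ppUnitary_sub_le hA hB hD x).trans
      (mul_le_mul_of_nonneg_left (norm_sub_pinching_le_commutationNorm hA hB) (by positivity))⟩,
    Submodule.disjoint_def.2 fun f hf hf' => eq_zero_of_mem_KSpace_of_linearDecay hfin hf hf'.2.1,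
    fun M ρ hM hρ => ?_⟩
  have h1 := evf_mem_KSpace_of_commute hA hD hM hρ.isSelfAdjoint hAD
  have h0 := evf_sub_mem_DecaySpace hA hB hM hρ.isSelfAdjoint
  have hsum : evf A B M ρ =
      evf A (pinching A B) M ρ + (evf A B M ρ - evf A (pinching A B) M ρ) := by abel
  refine ⟨Submodule.mem_sup.2 ⟨_, h1, _, h0, hsum.symm⟩, _, _, h1, h0, hsum,
    exists_evf_eq_sum_of_commute hA hD hM hρ.isSelfAdjoint hAD,
    ⟨h0.2.1.ofReal.memLp_two, ?_⟩, fun g₁ g₀ hg₁ hg₀ hg => ?_⟩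
  · have hs := h0.2.2
    rw [sSup_diffSet_Spec hA, neg_sub] at hs
    exact ae_fourier_toLp_eq_zero hs _
  · have e : g₁ - evf A (pinching A B) M ρ = evf A B M ρ - evf A (pinching A B) M ρ - g₀ := by
      rw [hg]; abel
    have hz : g₁ - evf A (pinching A B) M ρ = 0 :=
      eq_zero_of_mem_KSpace_of_linearDecay hfin (Submodule.sub_mem _ hg₁ h1)
        (e ▸ h0.2.1.sub hg₀)
    exact ⟨sub_eq_zero.1 hz, (sub_eq_zero.1 (e.symm.trans hz)).symm⟩
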